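/- Let $S=(\mathbb C^n,0)$, let $\mathcal O_S$ be its ring of germs of holomorphic functions and $\Theta_S=\operatorname{Der}_{\mathbb C}(\mathcal O_S)$. Let $D\subset S$ be a non-empty reduced hypersurface germ with ideal $\mathcal I_D=\mathcal O_S h$, let $\mathcal O_D=\mathcal O_S/\mathcal I_D$, and let $\mathcal M_D$ be the total quotient ring of $\mathcal O_D$. Let $\Omega^p_S(D)=\tfrac1h\Omega^p_S$, let $\Omega^1(\log D)=\{\omega\in\Omega^1_S(D)\mid d\omega\in\Omega^2_S(D)\}$ and $\operatorname{Der}(-\log D)=\{\delta\in\Theta_S\mid \delta(h)\in\mathcal I_D\}$, and let $\mathcal R_D\subseteq\mathcal M_D$ be the $\mathcal O_D$-module of residues of the elements of $\Omega^1(\log D)$, where $\omega=\frac{dh}{h}\frac{\xi}{g}+\frac{\eta}{g}$ with $\xi,g\in\mathcal O_S$, $\eta\in\Omega^1_S$ and $g|_D$ a non-zero-divisor of $\mathcal O_D$ has residue $\frac{\xi}{g}|_D$. Suppose that $D$ is free, that is, $\operatorname{Der}(-\log D)$ is a free $\mathcal O_S$-module. Call $D$ Euler homogeneous with respect to $h$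 if there is $\chi\in\operatorname{Der}(-\log D)$ with $\chi(h)=h$. Call $h$ adapted if for every $\delta\in\operatorname{Der}(-\log D)$ there is $\delta'\in\Theta_S$ with $\delta'(h)=0$ such that $\delta$ and $\delta'$ have the same value at $0$. (For instance, $h$ is adapted if all logarithmic vector fields vanish at $0$, that is, if $D$ is not isomorphic to some $D'\times(\mathbb C^r,0)$ with $r>0$; likewise if $D=D'\times(\mathbb C^r,0)$ for such a $D'$ and $h$ is the pullback of an equation of $D'$.) Then the following hold. 1. For the given generator $h$ of $\mathcal I_D$ (which is arbitrary), $\frac{dh}{h}$ is part of an $\mathcal O_S$-basis of $\Omega^1(\log D)$ if and only if $D$ is Euler homogeneous with respect to $h$. 2. $1$ is part of a minimal set of $\mathcal O_D$-generators of $\mathcal R_D$ if and only if $\frac{dh'}{h'}$ is part of an $\mathcal O_S$-basis of $\Omega^1(\log D)$ for every generator $h'$ of $\mathcal I_D$. 3. If $h$ is adapted, then $\frac{dh}{h}$ is part of an $\mathcal O_S$-basis of $\Omega^1(\log D)$ if and only if $1$ is part of a minimal set of $\mathcal O_D$-generators of $\mathcal R_D$. 4. $\mathcal R_D$ is a cyclic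 $\mathcal O_D$-module if and only if $D$ is smooth. -/

import Mathlib

open Filter Topology
open scoped nonZeroDivisors

noncomputable section

namespace FreeDivisor

/-! ### The smooth complex analytic space germ `S = (ℂⁿ, 0)` -/

/-- The pointwise `ℂ`-algebra structure on germs at `0` of arbitrary functions `ℂⁿ → ℂ`. -/
instance instAlgebraGerm (n : ℕ) : Algebra ℂ (Germ (𝓝 (0 : Fin n → ℂ)) ℂ) :=
  Algebra.ofModule
    (fun c f g => by
      induction f using Germ.inductionOn
      induction g using Germ.inductionOn
      simp only [← Germ.coe_mul, ← Germ.coe_smul, smul_mul_assoc])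
    (fun c f g => by
      induction f using Germ.inductionOn
      induction g using Germ.inductionOn
      simp only [← Germ.coe_mul, ← Germ.coe_smul, mul_smul_comm])

/-- The `ℂ`-algebra of germs at `0` of holomorphic functions on `ℂⁿ`. -/
def holGerms (n : ℕ) : Subalgebra ℂ (Germ (𝓝 (0 : Fin n → ℂ)) ℂ) where
  carrier := {φ | ∃ f : (Fin n → ℂ) → ℂ, AnalyticAt ℂ f 0 ∧
    φ = Germ.ofFun (l := 𝓝 (0 : Fin n → ℂ)) f}
  mul_mem' := by
    rintro _ _ ⟨f, hf, rfl⟩ ⟨g, hg, rfl⟩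
    exact ⟨f * g, hf.mul hg, rfl⟩
  add_mem' := by
    rintro _ _ ⟨f, hf, rfl⟩ ⟨g, hg, rfl⟩
    exact ⟨f + g, hf.add hg, rfl⟩
  algebraMap_mem' c := by
    refine ⟨fun _ => c • 1, analyticAt_const, ?_⟩
    rw [Algebra.algebraMap_eq_smul_one]
    rfl

/-- The local ring `𝒪_S` of `S = (ℂⁿ, 0)`. -/
def 𝒪 (n : ℕ) : Type := holGerms n

instance instCommRing𝒪 (n : ℕ) : CommRing (𝒪 n) := inferInstanceAs (CommRing (holGerms n))

instance instAlgebra𝒪 (n : ℕ) : Algebra ℂ (𝒪 n) := inferInstanceAs (Algebra ℂ (holGerms n))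

/-- The value at `0` of a germ; its kernel is the maximal ideal of `𝒪_S`. -/
def value₀ {n : ℕ} (f : 𝒪 n) : ℂ := Germ.value (Subtype.val f)

/-- Since `𝒪_S` is a domain, its total quotient ring is a field. -/
instance instIsDomain (n : ℕ) : IsDomain (𝒪 n) := by
  have : NoZeroDivisors (𝒪 n) := by
    refine ⟨?_⟩
    rintro ⟨_, f, hf, rfl⟩ ⟨_, g, hg, rfl⟩ hfg
    have h0 : ∀ᶠ x in 𝓝 (0 : Fin n → ℂ), f x * g x = 0 :=
      Germ.coe_eq.1 (congrArg Subtype.val hfg)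
    obtain ⟨r, hr, hball⟩ := Metric.eventually_nhds_iff_ball.1
      (h0.and (hf.eventually_analyticAt.and hg.eventually_analyticAt))
    by_cases hz : ∀ x ∈ Metric.ball (0 : Fin n → ℂ) r, f x = 0
    · left
      apply Subtype.ext
      exact Germ.coe_eq.2 (Filter.eventually_of_mem (Metric.ball_mem_nhds 0 hr) hz)
    · right
      push Not at hz
      obtain ⟨p, hp, hfp⟩ := hz
      have hU : IsPreconnected (Metric.ball (0 : Fin n → ℂ) r) :=
        (convex_ball _ _).isPreconnected
      have hgan : AnalyticOnNhd ℂ g (Metric.ball (0 : Fin n → ℂ) r) :=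
        fun x hx => (hball x hx).2.2
      have hgp : g =ᶠ[𝓝 p] 0 := by
        filter_upwards [(hball p hp).2.1.continuousAt.eventually_ne hfp,
          Metric.isOpen_ball.mem_nhds hp] with x hx hx'
        exact (mul_eq_zero.1 (hball x hx').1).resolve_left hx
      have := hgan.eqOn_zero_of_preconnected_of_eventuallyEq_zero hU hp hgp
      apply Subtype.ext
      exact Germ.coe_eq.2 (Filter.eventually_of_mem (Metric.ball_mem_nhds 0 hr) this)
  have : Nontrivial (𝒪 n) := inferInstanceAs (Nontrivial (holGerms n))
  exact NoZeroDivisors.to_isDomain _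

/-! ### Derivatives -/

/-- The germ at `0` of `∂f/∂xᵢ`, for germs of functions. -/
def germPartial {n : ℕ} (i : Fin n) :
    Germ (𝓝 (0 : Fin n → ℂ)) ℂ → Germ (𝓝 (0 : Fin n → ℂ)) ℂ :=
  Quotient.map' (fun f x => fderiv ℂ f x (Pi.single i 1))
    (fun _ _ hfg => (Filter.EventuallyEq.fderiv (𝕜 := ℂ) hfg).mono fun _ hx => by simp only [hx])

/-- The partial derivative `∂/∂xᵢ` as a `ℂ`-derivation of `𝒪_S`. -/
def pd {n : ℕ} (i : Fin n) : Derivation ℂ (𝒪 n) (𝒪 n) :=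
  Derivation.mk'
    { toFun := fun φ => ⟨germPartial i (Subtype.val φ), by
        obtain ⟨_, f, hf, rfl⟩ := φ
        exact ⟨_, ((ContinuousLinearMap.apply ℂ ℂ (Pi.single i 1 : Fin n → ℂ)).analyticAt _).comp
          (AnalyticAt.fderiv hf), rfl⟩⟩
      map_add' := by
        rintro ⟨_, f, hf, rfl⟩ ⟨_, g, hg, rfl⟩
        apply Subtype.ext
        refine Germ.coe_eq.2 ?_
        filter_upwards [hf.eventually_analyticAt, hg.eventually_analyticAt] with x hx hx'
        have := congrArg (fun L => L (Pi.single i 1))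
          (fderiv_add hx.differentiableAt hx'.differentiableAt)
        exact this
      map_smul' := by
        rintro c ⟨_, f, hf, rfl⟩
        apply Subtype.ext
        refine Germ.coe_eq.2 ?_
        filter_upwards [hf.eventually_analyticAt] with x hx
        have := congrArg (fun L => L (Pi.single i 1))
          (fderiv_const_smul hx.differentiableAt c)
        exact this }
    (by
      rintro ⟨_, f, hf, rfl⟩ ⟨_, g, hg, rfl⟩
      apply Subtype.ext
      refine Germ.coe_eq.2 ?_
      filter_upwards [hf.eventually_analyticAt, hg.eventually_analyticAt] with x hx hx'
      have := congrArg (fun L => L (Pi.single i 1))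
        (fderiv_mul hx.differentiableAt hx'.differentiableAt)
      exact this)

/-- The field of germs of meromorphic functions on `S`. -/
abbrev Mer (n : ℕ) : Type := FractionRing (𝒪 n)

/-- The extension of `∂/∂xᵢ` to meromorphic germs by the quotient rule, evaluated on a chosen
representation as a fraction; the choice is irrelevant by `merPd_div`. -/
def merPd {n : ℕ} (i : Fin n) (x : Mer n) : Mer n :=
  let a : 𝒪 n := (IsLocalization.sec (𝒪 n)⁰ x).1
  let s : 𝒪 n := (IsLocalization.sec (𝒪 n)⁰ x).2
  algebraMap (𝒪 n) (Mer n) (pd i a * s - a * pd i s) / algebraMap (𝒪 n) (Mer n) s ^ 2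

theorem merPd_div {n : ℕ} (i : Fin n) (a s : 𝒪 n) (hs : s ≠ 0) :
    merPd i (algebraMap (𝒪 n) (Mer n) a / algebraMap (𝒪 n) (Mer n) s) =
      algebraMap (𝒪 n) (Mer n) (pd i a * s - a * pd i s) /
        algebraMap (𝒪 n) (Mer n) s ^ 2 := by
  set x : Mer n := algebraMap (𝒪 n) (Mer n) a / algebraMap (𝒪 n) (Mer n) s with hx
  have hinj := IsFractionRing.injective (𝒪 n) (Mer n)
  have hs' : algebraMap (𝒪 n) (Mer n) s ≠ 0 := by
    simpa using hinj.ne hs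
  have hsec := IsLocalization.sec_spec (𝒪 n)⁰ x
  unfold merPd
  set b : 𝒪 n := (IsLocalization.sec (𝒪 n)⁰ x).1
  set t : 𝒪 n := ((IsLocalization.sec (𝒪 n)⁰ x).2 : 𝒪 n) with ht
  have ht0 : t ≠ 0 := nonZeroDivisors.ne_zero (IsLocalization.sec (𝒪 n)⁰ x).2.2
  have ht' : algebraMap (𝒪 n) (Mer n) t ≠ 0 := by
    simpa using hinj.ne ht0
  have hE : a * t = b * s := by
    apply hinj
    rw [map_mul, map_mul, ← hsec, hx]
    field_simp
  have hD : pd i a * t + a * pd i t = pd i b * s + b * pd i s := by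
    have := congrArg (pd i) hE
    simp only [Derivation.leibniz, smul_eq_mul] at this
    linear_combination this
  simp only
  rw [div_eq_div_iff (pow_ne_zero 2 ht') (pow_ne_zero 2 hs'), ← map_pow, ← map_pow,
    ← map_mul, ← map_mul]
  congr 1
  linear_combination (-s * t) * hD + (pd i t * s + pd i s * t) * hE

/-! ### Divisors and logarithmic modules -/

/-- `h` generates the ideal `ℐ_D` of a (nonempty) reduced effective divisor germ `D` in
`S = (ℂⁿ, 0)`. -/
structure IsReducedEquation {n : ℕ} (h : 𝒪 n) : Prop where
  ne_zero : h ≠ 0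
  value_eq_zero : value₀ h = 0
  isReduced : IsReduced (𝒪 n ⧸ Ideal.span {h})

/-- `𝒪_D = 𝒪_S / ℐ_D`. -/
abbrev 𝒪D {n : ℕ} (h : 𝒪 n) : Type := 𝒪 n ⧸ Ideal.span {h}

/-- `ℳ_D`, the total quotient ring of `𝒪_D`. -/
abbrev MerD {n : ℕ} (h : 𝒪 n) : Type := FractionRing (𝒪D h)

/-- `D` is smooth: as a complex analytic space germ it is isomorphic to some `(ℂᵐ, 0)`. -/
def IsSmoothGerm {n : ℕ} (h : 𝒪 n) : Prop :=
  ∃ m : ℕ, Nonempty (𝒪D h ≃ₐ[ℂ] 𝒪 m)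

/-- `Θ_S = Der_ℂ(𝒪_S)`. -/
abbrev Θ (n : ℕ) : Type := Derivation ℂ (𝒪 n) (𝒪 n)

/-- `Der(-log D) = {δ ∈ Θ_S | dh(δ) ∈ ℐ_D}`, where `dh(δ) = δ(h)`. -/
def derLog {n : ℕ} (h : 𝒪 n) : Submodule (𝒪 n) (Θ n) where
  carrier := {δ | δ h ∈ Ideal.span {h}}
  add_mem' ha hb := by simpa using Ideal.add_mem _ ha hb
  zero_mem' := by simp
  smul_mem' c _ hx := by simpa using Ideal.mul_mem_left _ c hx

/-- `D` is free. -/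
def IsFreeDivisor {n : ℕ} (h : 𝒪 n) : Prop := Module.Free (𝒪 n) (derLog h)

/-- A meromorphic function has at most a simple pole along `D`, i.e. lies in
`𝒪_S(D) = h⁻¹ 𝒪_S`. -/
def HasSimplePole {n : ℕ} (h : 𝒪 n) (x : Mer n) : Prop :=
  ∃ f : 𝒪 n, algebraMap (𝒪 n) (Mer n) h * x = algebraMap (𝒪 n) (Mer n) f

/-- Meromorphic `1`-forms `∑ ωᵢ dxᵢ`, given by their coefficients. -/
abbrev MerForm (n : ℕ) : Type := Fin n → Mer n

/-- The coefficient of `dxᵢ ∧ dxⱼ` (for `i < j`) in `dω`. -/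
def diffForm {n : ℕ} (ω : MerForm n) (i j : Fin n) : Mer n := merPd i (ω j) - merPd j (ω i)

theorem merPd_add {n : ℕ} (i : Fin n) (x y : Mer n) :
    merPd i (x + y) = merPd i x + merPd i y := by
  obtain ⟨a, s, hs, rfl⟩ := IsFractionRing.div_surjective (A := 𝒪 n) x
  obtain ⟨b, t, ht, rfl⟩ := IsFractionRing.div_surjective (A := 𝒪 n) y
  have hinj := IsFractionRing.injective (𝒪 n) (Mer n)
  have hs0 := nonZeroDivisors.ne_zero hs
  have ht0 := nonZeroDivisors.ne_zero ht
  have hs' : algebraMap (𝒪 n) (Mer n) s ≠ 0 := by simpa using hinj.ne hs0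
  have ht' : algebraMap (𝒪 n) (Mer n) t ≠ 0 := by simpa using hinj.ne ht0
  rw [div_add_div _ _ hs' ht', ← map_mul, ← map_mul, ← map_mul, ← map_add,
    merPd_div i _ _ (mul_ne_zero hs0 ht0), merPd_div i _ _ hs0, merPd_div i _ _ ht0]
  simp only [Derivation.leibniz, smul_eq_mul, map_mul, map_add, map_sub]
  field_simp
  ring

theorem merPd_smul {n : ℕ} (i : Fin n) (c : 𝒪 n) (x : Mer n) :
    merPd i (c • x) = c • merPd i x + pd i c • x := by
  obtain ⟨a, s, hs, rfl⟩ := IsFractionRing.div_surjective (A := 𝒪 n) x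
  have hinj := IsFractionRing.injective (𝒪 n) (Mer n)
  have hs0 := nonZeroDivisors.ne_zero hs
  have hs' : algebraMap (𝒪 n) (Mer n) s ≠ 0 := by simpa using hinj.ne hs0
  simp only [Algebra.smul_def]
  rw [← mul_div_assoc, ← map_mul, merPd_div i _ _ hs0, merPd_div i _ _ hs0]
  simp only [Derivation.leibniz, smul_eq_mul, map_mul, map_add, map_sub]
  field_simp
  ring

/-- `Ω¹(log D) = {ω ∈ Ω¹_S(D) | dω ∈ Ω²_S(D)}`. -/
def logForms {n : ℕ} (h : 𝒪 n) : Submodule (𝒪 n) (MerForm n) where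
  carrier := {ω | (∀ i, HasSimplePole h (ω i)) ∧ ∀ i j, HasSimplePole h (diffForm ω i j)}
  add_mem' := by
    rintro ω η ⟨h1, h2⟩ ⟨h3, h4⟩
    refine ⟨fun i => ?_, fun i j => ?_⟩
    · obtain ⟨f, hf⟩ := h1 i
      obtain ⟨g, hg⟩ := h3 i
      exact ⟨f + g, by rw [Pi.add_apply, mul_add, hf, hg, map_add]⟩
    · obtain ⟨f, hf⟩ := h2 i j
      obtain ⟨g, hg⟩ := h4 i j
      refine ⟨f + g, ?_⟩
      rw [map_add, ← hf, ← hg]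
      simp only [diffForm, Pi.add_apply, merPd_add]
      ring
  zero_mem' := by
    have h0 : ∀ i : Fin n, merPd i (0 : Mer n) = 0 := fun i => by
      simpa using merPd_smul i 0 0
    exact ⟨fun i => ⟨0, by simp⟩, fun i j => ⟨0, by simp [diffForm, h0]⟩⟩
  smul_mem' := by
    rintro c ω ⟨h1, h2⟩
    refine ⟨fun i => ?_, fun i j => ?_⟩
    · obtain ⟨f, hf⟩ := h1 i
      exact ⟨c * f, by rw [Pi.smul_apply, mul_smul_comm, hf, map_mul, Algebra.smul_def]⟩
    · obtain ⟨f, hf⟩ := h2 i j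
      obtain ⟨u, hu⟩ := h1 i
      obtain ⟨v, hv⟩ := h1 j
      refine ⟨c * f + (pd i c * v - pd j c * u), ?_⟩
      simp only [map_add, map_mul, map_sub, ← hf, ← hu, ← hv]
      simp only [diffForm, Pi.smul_apply, merPd_smul]
      simp only [Algebra.smul_def]
      ring

/-- The logarithmic differential `dh/h`. -/
def dlog {n : ℕ} (h : 𝒪 n) : MerForm n := fun i =>
  algebraMap (𝒪 n) (Mer n) (pd i h) / algebraMap (𝒪 n) (Mer n) h

/-- `ω` is a member of some `R`-basis of the submodule `N`. -/
def IsPartOfBasis {R M : Type} [CommRing R] [AddCommGroup M] [Module R M]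
    (N : Submodule R M) (ω : M) : Prop :=
  ∃ (ι : Type) (b : Module.Basis ι R N) (i : ι), (b i : M) = ω

/-- `ω` is a member of some minimal (with respect to inclusion) set of generators of the
submodule `N`. -/
def IsPartOfMinimalGenerators {R M : Type} [CommRing R] [AddCommGroup M] [Module R M]
    (N : Submodule R M) (ω : M) : Prop :=
  ∃ G : Set M, Minimal (fun G' : Set M => Submodule.span R G' = N) G ∧ ω ∈ G

/-! ### Logarithmic residues -/

/-- `r` is the residue of `ω`: there are `ξ ∈ 𝒪_S`, `η ∈ Ω¹_S` and `g ∈ 𝒪_S` restricting to a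
non zero divisor of `𝒪_D` with `ω = dh/h ⬝ ξ/g + η/g` and `r = (ξ/g)|_D`. -/
def IsResidue {n : ℕ} (h : 𝒪 n) (ω : MerForm n) (r : MerD h) : Prop :=
  ∃ (g : 𝒪 n) (ξ : 𝒪 n) (η : Fin n → 𝒪 n) (hg : Ideal.Quotient.mk (Ideal.span {h}) g ∈ (𝒪D h)⁰),
    (∀ i, ω i = dlog h i * (algebraMap (𝒪 n) (Mer n) ξ / algebraMap (𝒪 n) (Mer n) g) +
      algebraMap (𝒪 n) (Mer n) (η i) / algebraMap (𝒪 n) (Mer n) g) ∧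
    r = IsLocalization.mk' (MerD h) (Ideal.Quotient.mk (Ideal.span {h}) ξ)
      (⟨Ideal.Quotient.mk (Ideal.span {h}) g, hg⟩ : (𝒪D h)⁰)

/-- `ℛ_D = ρ_D(Ω¹(log D)) ⊆ ℳ_D`, the `𝒪_D`-module of residues of logarithmic `1`-forms. -/
def residues {n : ℕ} (h : 𝒪 n) : Submodule (𝒪D h) (MerD h) where
  carrier := {r | ∃ ω ∈ logForms h, IsResidue h ω r}
  add_mem' := by
    rintro _ _ ⟨ω, hω, g, ξ, η, hg, e, rfl⟩ ⟨ω', hω', g', ξ', η', hg', e', rfl⟩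
    by_cases h0 : g = 0 ∨ g' = 0
    · have hz : (0 : 𝒪D h) ∈ (𝒪D h)⁰ := by
        rcases h0 with rfl | rfl
        · simpa using hg
        · simpa using hg'
      have : Subsingleton (MerD h) :=
        IsLocalization.subsingleton (M := (𝒪D h)⁰) hz
      exact ⟨ω, hω, g, ξ, η, hg, e, Subsingleton.elim _ _⟩
    push Not at h0
    have hgg : Ideal.Quotient.mk (Ideal.span {h}) (g * g') ∈ (𝒪D h)⁰ := by
      rw [map_mul]; exact mul_mem hg hg'
    have hinj := IsFractionRing.injective (𝒪 n) (Mer n)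
    have h1 : algebraMap (𝒪 n) (Mer n) g ≠ 0 := by simpa using hinj.ne h0.1
    have h2 : algebraMap (𝒪 n) (Mer n) g' ≠ 0 := by simpa using hinj.ne h0.2
    refine ⟨ω + ω', add_mem hω hω', g * g', ξ * g' + ξ' * g,
      fun i => η i * g' + η' i * g, hgg, fun i => ?_, ?_⟩
    · rw [Pi.add_apply, e, e']
      simp only [map_add, map_mul]
      field_simp
      ring
    · rw [← IsLocalization.mk'_add]
      congr 1
  zero_mem' := by
    refine ⟨0, zero_mem _, 1, 0, 0, by simp [one_mem], fun i => by simp, by simp⟩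
  smul_mem' := by
    rintro c _ ⟨ω, hω, g, ξ, η, hg, e, rfl⟩
    obtain ⟨c, rfl⟩ := Ideal.Quotient.mk_surjective c
    refine ⟨c • ω, Submodule.smul_mem _ _ hω, g, c * ξ, fun i => c * η i, hg, fun i => ?_, ?_⟩
    · rw [Pi.smul_apply, e, Algebra.smul_def, map_mul, map_mul]
      ring
    · rw [map_mul, ← IsLocalization.smul_mk']

/-- Euler homogeneity of `D` with respect to its equation `h`: there is an Euler vector field,
that is, a `χ ∈ Der(-log D)` with `χ(h) = h`. -/
def IsEulerHomogeneous {n : ℕ} (h : 𝒪 n) : Prop :=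
  ∃ χ ∈ derLog h, χ h = h

/-- Every logarithmic vector field has the same value at `0` as a vector field annihilating `h`.
This holds if all logarithmic vector fields vanish at `0`, i.e. if `D` is not of the form
`D' × (ℂʳ, 0)` with `r > 0`, and also if `D = D' × (ℂʳ, 0)` with such a `D'` and `h` is the
pullback of an equation of `D'`. -/
def IsAdaptedEquation {n : ℕ} (h : 𝒪 n) : Prop :=
  ∀ δ ∈ derLog h, ∃ δ' : Θ n, δ' h = 0 ∧ ∀ f : 𝒪 n, value₀ (δ f) = value₀ (δ' f)

end FreeDivisor

end

open FreeDivisor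

/-! Write a logarithmic form as `a / h` with `a` in `logNum h`, that is, `h` divides `dh ∧ a`.
Contraction, divided by `h`, is a pairing of `derLog h` with `logNum h` which identifies `logNum h`
with the dual of `derLog h` (`pairing_flip_bijective`). If `D` is free, both modules are finite free
and dual to each other, so `a / h` is in a basis iff some logarithmic field pairs to `1` with `a`,
iff `a` is not in `𝔪 • logNum h`. Pairing `δ` with `dh` gives `δ(h) / h`, whence claim 1.

The residue map kills exactly the holomorphic forms and sends `dh / h` to `1`. By Nakayama, `1`
fails to be a minimal generator iff some `dh + h η` lies in `𝔪 • logNum h`. Modulo `𝔪 • logNum h`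
only `η(0)` matters, and every value `η(0)` is attained by `du / u` for a unit `u`, where `dh + h
du/u` belongs to the equation `hu`. This is claim 2. If `h` is adapted, an Euler field can be
corrected to vanish at `0`; it then has unit pairing with all these forms at once, which gives claim
3.

For claim 4, suppose the residues are cyclic. Then the values at `0` of logarithmic fields form a
hyperplane (`functional_minor_eq_zero`, `logTangent_ne_top`), so `derLog h` and one `∂ₚ` generate
all vector fields. The ideals `J_k` generated by `h, ∂ₚ h, ..., ∂ₚᵏ h` are stable under `derLog h`.
Some derivative of `h` along `∂ₚ` is a unit; let `k + 1` be the least such order and `f = ∂ₚᵏ h`. On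
the smooth hypersurface `f = 0` the image of `J_k` is stable under all derivations, hence zero, so
`J_k = (f)`. If `k ≥ 1`, reducedness of `h` would force `∂ₚ f ∈ (f)`, which is absurd, so `k = 0`
and `D` is smooth.

No Noetherian property of the ring of germs is needed: its role is played by Hadamard's lemma and by
nonvanishing iterated derivatives. -/

noncomputable section

namespace FreeDivisor

open IsLocalRing

/-! ### Germs of holomorphic functions -/

/-- The germ at `0` of a function that is holomorphic near `0`. -/
def holGerm {n : ℕ} (f : (Fin n → ℂ) → ℂ) (hf : AnalyticAt ℂ f 0) : 𝒪 n :=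
  ⟨Germ.ofFun (l := 𝓝 (0 : Fin n → ℂ)) f, f, hf, rfl⟩

theorem exists_holGerm_eq {n : ℕ} (φ : 𝒪 n) : ∃ f hf, holGerm f hf = φ := by
  obtain ⟨_, f, hf, rfl⟩ := φ
  exact ⟨f, hf, rfl⟩

theorem holGerm_eq_iff {n : ℕ} {f g : (Fin n → ℂ) → ℂ} (hf : AnalyticAt ℂ f 0)
    (hg : AnalyticAt ℂ g 0) : holGerm f hf = holGerm g hg ↔ f =ᶠ[𝓝 0] g :=
  ⟨fun e => Germ.coe_eq.1 (congrArg Subtype.val e), fun e => Subtype.ext (Germ.coe_eq.2 e)⟩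

/-- The value at `0` as a homomorphism of `ℂ`-algebras. -/
def valueHom (n : ℕ) : 𝒪 n →ₐ[ℂ] ℂ where
  toFun := value₀
  map_one' := rfl
  map_zero' := rfl
  map_mul' := by
    rintro ⟨_, f, hf, rfl⟩ ⟨_, g, hg, rfl⟩
    rfl
  map_add' := by
    rintro ⟨_, f, hf, rfl⟩ ⟨_, g, hg, rfl⟩
    rfl
  commutes' c := by
    change Germ.value (algebraMap ℂ (Germ (𝓝 (0 : Fin n → ℂ)) ℂ) c) = c
    rw [Algebra.algebraMap_eq_smul_one]
    change c • (1 : ℂ) = c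
    simp

theorem valueHom_apply {n : ℕ} (f : 𝒪 n) : valueHom n f = value₀ f := rfl

theorem value₀_holGerm {n : ℕ} (f : (Fin n → ℂ) → ℂ) (hf : AnalyticAt ℂ f 0) :
    value₀ (holGerm f hf) = f 0 := rfl

theorem isUnit_iff_value_ne_zero {n : ℕ} (f : 𝒪 n) : IsUnit f ↔ value₀ f ≠ 0 := by
  refine ⟨fun hu => (hu.map (valueHom n)).ne_zero, fun hv => ?_⟩
  obtain ⟨f, hf, rfl⟩ := exists_holGerm_eq f
  rw [value₀_holGerm] at hv
  refine IsUnit.of_mul_eq_one (holGerm f⁻¹ (hf.inv hv)) ?_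
  apply Subtype.ext
  refine Germ.coe_eq.2 ?_
  filter_upwards [hf.continuousAt.eventually_ne hv] with x hx
  exact mul_inv_cancel₀ hx

instance isLocalHom_valueHom (n : ℕ) : IsLocalHom (valueHom n).toRingHom :=
  ⟨fun f hf => (isUnit_iff_value_ne_zero f).2 hf.ne_zero⟩

instance isLocalRing𝒪 (n : ℕ) : IsLocalRing (𝒪 n) :=
  (valueHom n).toRingHom.domain_isLocalRing

theorem mem_maximalIdeal_iff {n : ℕ} (f : 𝒪 n) :
    f ∈ maximalIdeal (𝒪 n) ↔ value₀ f = 0 := by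
  rw [IsLocalRing.mem_maximalIdeal, mem_nonunits_iff, isUnit_iff_value_ne_zero, not_not]

/-- The coordinate functions on `S`. -/
def coord {n : ℕ} (i : Fin n) : 𝒪 n :=
  holGerm (fun x => x i) ((ContinuousLinearMap.proj (R := ℂ) (φ := fun _ : Fin n => ℂ) i).analyticAt 0)

theorem value₀_coord {n : ℕ} (i : Fin n) : value₀ (coord i) = 0 := rfl

theorem coord_mem {n : ℕ} (i : Fin n) : coord i ∈ maximalIdeal (𝒪 n) :=
  (mem_maximalIdeal_iff _).2 rfl

theorem pd_coord {n : ℕ} (i j : Fin n) : pd i (coord j) = if i = j then 1 else 0 := by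
  have : ∀ x : Fin n → ℂ, fderiv ℂ (fun x : Fin n → ℂ => x j) x (Pi.single i 1)
      = if i = j then 1 else 0 := by
    intro x
    have h := (ContinuousLinearMap.proj (R := ℂ) (φ := fun _ : Fin n => ℂ) j).hasFDerivAt (x := x)
    rw [show (fun x : Fin n → ℂ => x j) =
      (ContinuousLinearMap.proj (R := ℂ) (φ := fun _ : Fin n => ℂ) j) from rfl, h.fderiv]
    simp [Pi.single_apply, eq_comm]
  apply Subtype.ext
  split_ifs with hij
  · refine Germ.coe_eq.2 (Eventually.of_forall fun x => ?_)
    exact (this x).trans (if_pos hij)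
  · refine Germ.coe_eq.2 (Eventually.of_forall fun x => ?_)
    exact (this x).trans (if_neg hij)

/-! ### Pullbacks -/

/-- Pullback of germs along the germ of a holomorphic map. -/
def pullback {a b : ℕ} (F : (Fin a → ℂ) → (Fin b → ℂ)) (hF : AnalyticAt ℂ F 0) (h0 : F 0 = 0) :
    𝒪 b →ₐ[ℂ] 𝒪 a where
  toFun φ := ⟨(Subtype.val φ).compTendsto F (by
      have := hF.continuousAt.tendsto
      rwa [h0] at this), by
    obtain ⟨_, f, hf, rfl⟩ := φ
    exact ⟨f ∘ F, AnalyticAt.comp (by rwa [h0]) hF, rfl⟩⟩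
  map_one' := rfl
  map_zero' := rfl
  map_mul' := by
    rintro ⟨_, f, hf, rfl⟩ ⟨_, g, hg, rfl⟩
    rfl
  map_add' := by
    rintro ⟨_, f, hf, rfl⟩ ⟨_, g, hg, rfl⟩
    rfl
  commutes' c := by
    apply Subtype.ext
    change (algebraMap ℂ (Germ (𝓝 (0 : Fin b → ℂ)) ℂ) c).compTendsto F
      (by simpa [h0] using hF.continuousAt.tendsto) =
      algebraMap ℂ (Germ (𝓝 (0 : Fin a → ℂ)) ℂ) c
    rw [Algebra.algebraMap_eq_smul_one, Algebra.algebraMap_eq_smul_one]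
    rfl

/-! ### Division by a coordinate -/

/-- A germ minus its restriction to the hyperplane `xₚ = 0` is divisible by `xₚ`. -/
theorem exists_sub_update_eq_mul {n : ℕ} (p : Fin n) {f : (Fin n → ℂ) → ℂ}
    (hf : AnalyticAt ℂ f 0) :
    ∃ k : (Fin n → ℂ) → ℂ, AnalyticAt ℂ k 0 ∧
      ∀ᶠ x in 𝓝 0, f x - f (Function.update x p 0) = x p * k x := by
  obtain ⟨P, R, hP⟩ := hf
  let Q : (Fin n → ℂ) →L[ℂ] (Fin n → ℂ) := ContinuousLinearMap.pi fun i =>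
    if i = p then 0 else ContinuousLinearMap.proj (R := ℂ) (φ := fun _ : Fin n => ℂ) i
  have hQ : ∀ x, Q x = Function.update x p 0 := by
    intro x
    ext i
    by_cases hi : i = p
    · subst hi; simp [Q]
    · simp [Q, hi]
  have hQn : ‖Q‖ ≤ 1 := by
    refine ContinuousLinearMap.opNorm_le_bound _ zero_le_one fun x => ?_
    rw [one_mul, pi_norm_le_iff_of_nonneg (norm_nonneg _)]
    intro i
    by_cases hi : i = p
    · subst hi; simp [Q]
    · simpa [Q, hi] using norm_le_pi_norm x i
  -- The quotient series comes from telescoping `P (k + 1)` at `x` minus `P (k + 1)` at `Q x` slot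
  -- by slot: slots before `j` hold `x`, slots after `j` hold `Q x`, and slot `j` holds `x - Q x = x
  -- p • e`. Slot `j` itself is left uncomposed, since `Q e = 0`.
  let A : (k : ℕ) → Fin (k + 1) → Fin (k + 1) → ((Fin n → ℂ) →L[ℂ] (Fin n → ℂ)) := fun k j i =>
    if i ≤ j then ContinuousLinearMap.id ℂ (Fin n → ℂ) else Q
  let e : (Fin n → ℂ) := Pi.single p 1
  let c : FormalMultilinearSeries ℂ (Fin n → ℂ) ℂ := fun k =>
    ∑ j : Fin (k + 1), ((P (k + 1)).compContinuousLinearMap (A k j)).curryMid j e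
  have he : ‖e‖ = 1 := by simp [e, Pi.norm_single]
  have hAn : ∀ k j i, ‖A k j i‖ ≤ 1 := by
    intro k j i
    simp only [A]
    split_ifs
    · exact ContinuousLinearMap.norm_id_le
    · exact hQn
  have hcn : ∀ k, ‖c k‖ ≤ (k + 1) * ‖P (k + 1)‖ := by
    intro k
    refine (norm_sum_le _ _).trans ?_
    have : ∀ j ∈ (Finset.univ : Finset (Fin (k + 1))),
        ‖((P (k + 1)).compContinuousLinearMap (A k j)).curryMid j e‖ ≤ ‖P (k + 1)‖ := by
      intro j _
      refine (ContinuousLinearMap.le_opNorm _ _).trans ?_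
      rw [he, mul_one, ContinuousMultilinearMap.norm_curryMid]
      refine (ContinuousMultilinearMap.norm_compContinuousLinearMap_le _ _).trans ?_
      refine mul_le_of_le_one_right (norm_nonneg _) ?_
      exact Finset.prod_le_one (fun i _ => norm_nonneg _) (fun i _ => hAn k j i)
    refine (Finset.sum_le_card_nsmul _ _ _ this).trans ?_
    simp
  have hPr : 0 < P.radius := hP.r_pos.trans_le hP.r_le
  obtain ⟨C, a, hC, ha, hPa⟩ := P.le_mul_pow_of_radius_pos hPr
  have hcr : 0 < c.radius := by
    have ha2 : (0 : ℝ) < 1 / (2 * a) := by positivity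
    refine lt_of_lt_of_le ?_ (c.le_radius_of_bound (C * a) (r := ⟨1 / (2 * a), ha2.le⟩) ?_)
    · exact ENNReal.coe_pos.2 ha2
    · intro k
      -- The `k + 1` summands of `c k` are absorbed by halving the radius `1 / a`.
      have h1 : ((k : ℝ) + 1) ≤ 2 ^ k := by
        exact_mod_cast Nat.lt_two_pow_self (n := k)
      calc ‖c k‖ * (1 / (2 * a)) ^ k
          ≤ (2 ^ k * (C * a ^ (k + 1))) * (1 / (2 * a)) ^ k := by
            gcongr
            exact (hcn k).trans (by gcongr; exact hPa _)
        _ = C * a := by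
            rw [pow_succ, one_div, inv_pow, mul_pow]
            field_simp
  have hc := c.hasFPowerSeriesOnBall hcr
  have key : ∀ k (x : (Fin n → ℂ)), (P (k + 1) fun _ => x) - (P (k + 1) fun _ => Q x)
      = x p * c k fun _ => x := by
    intro k x
    let T : ℕ → ℂ := fun j => P (k + 1) fun i => if (i : ℕ) < j then x else Q x
    have hT : ∀ j : Fin (k + 1), x p * (((P (k + 1)).compContinuousLinearMap (A k j)).curryMid j e
        fun _ => x) = T (j + 1) - T j := by
      intro j
      have h1 : (((P (k + 1)).compContinuousLinearMap (A k j)).curryMid j e fun _ => x) =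
          P (k + 1) (Function.update (fun i : Fin (k + 1) => if (i : ℕ) < j then x else Q x) j e) := by
        rw [ContinuousMultilinearMap.curryMid_apply,
          ContinuousMultilinearMap.compContinuousLinearMap_apply]
        congr 1
        ext1 i
        rcases eq_or_ne i j with rfl | hij
        · simp [A]
        · obtain ⟨i', rfl⟩ := Fin.exists_succAbove_eq hij
          rw [Fin.insertNth_apply_succAbove, Function.update_of_ne hij]
          have : j.succAbove i' ≤ j ↔ ((j.succAbove i' : Fin (k + 1)) : ℕ) < j := by
            rw [← Fin.lt_def]
            exact ⟨fun h => lt_of_le_of_ne h hij, le_of_lt⟩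
          simp only [A, this]
          split_ifs <;> rfl
      have h2 : x p • e = x - Q x := by
        ext i
        rcases eq_or_ne i p with rfl | hi
        · simp [e, hQ]
        · simp [e, hQ, hi]
      have h3 : T (j + 1) = P (k + 1)
          (Function.update (fun i : Fin (k + 1) => if (i : ℕ) < j then x else Q x) j x) := by
        simp only [T]
        congr 1
        ext1 i
        rcases eq_or_ne i j with rfl | hij
        · simp
        · rw [Function.update_of_ne hij]
          have : (i : ℕ) ≠ j := fun h => hij (Fin.ext h)
          have : (i : ℕ) < j + 1 ↔ (i : ℕ) < j := by omega
          simp only [this]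
      have h4 : T j = P (k + 1)
          (Function.update (fun i : Fin (k + 1) => if (i : ℕ) < j then x else Q x) j (Q x)) := by
        simp only [T]
        congr 1
        ext1 i
        rcases eq_or_ne i j with rfl | hij
        · simp
        · rw [Function.update_of_ne hij]
      rw [h1, h3, h4, ← smul_eq_mul, ← ContinuousMultilinearMap.map_update_smul, h2,
        ContinuousMultilinearMap.map_update_sub]
    have h5 : (c k fun _ => x) = ∑ j : Fin (k + 1),
        ((P (k + 1)).compContinuousLinearMap (A k j)).curryMid j e fun _ => x := by
      simp only [c, _root_.sum_apply]
    rw [h5, Finset.mul_sum, Finset.sum_congr rfl fun j _ => hT j,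
      Fin.sum_univ_eq_sum_range (fun j => T (j + 1) - T j), Finset.sum_range_sub]
    congr 1
    · simp only [T]
      congr 1
      ext1 i
      simp [i.2]
  refine ⟨c.sum, ⟨c, _, hc⟩, ?_⟩
  filter_upwards [Metric.eball_mem_nhds (0 : (Fin n → ℂ)) hP.r_pos, Metric.eball_mem_nhds (0 : (Fin n → ℂ)) hcr]
    with x hx hx'
  have hQx : Q x ∈ Metric.eball (0 : (Fin n → ℂ)) R := by
    rw [Metric.mem_eball, edist_zero_right] at hx ⊢
    refine lt_of_le_of_lt ?_ hx
    rw [enorm_le_iff_norm_le]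
    exact (Q.le_opNorm x).trans (mul_le_of_le_one_left (norm_nonneg _) hQn)
  have s1 := hP.hasSum hx
  have s2 := hP.hasSum hQx
  have s3 := hc.hasSum hx'
  rw [zero_add] at s1 s2 s3
  -- The constant terms cancel; dropping them aligns degree `k + 1` of `P` with degree `k` of `c`.
  have s4 := (hasSum_nat_add_iff' (f := fun m => (P m fun _ => x) - (P m fun _ => Q x)) 1).2
    (s1.sub s2)
  have s5 := s3.mul_left (x p)
  simp only [key] at s4
  have := s4.unique s5
  rw [← this, hQ]
  have h0 : (P 0 fun _ => x) = (P 0 fun _ => Q x) := by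
    congr 1
    ext1 i
    exact i.elim0
  simp [h0, hQ]

/-- The projection of `ℂⁿ` which annihilates the coordinates in `s`. -/
def killCoords {n : ℕ} (s : Finset (Fin n)) : (Fin n → ℂ) →L[ℂ] (Fin n → ℂ) :=
  ContinuousLinearMap.pi fun i =>
    if i ∈ s then 0 else ContinuousLinearMap.proj (R := ℂ) (φ := fun _ : Fin n => ℂ) i

theorem killCoords_apply {n : ℕ} (s : Finset (Fin n)) (x : Fin n → ℂ) (i : Fin n) :
    killCoords s x i = if i ∈ s then 0 else x i := by
  simp only [killCoords, ContinuousLinearMap.coe_pi']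
  split_ifs <;> simp

/-- Pullback of germs under a linear map. -/
def linearPullback {a b : ℕ} (F : (Fin a → ℂ) →L[ℂ] (Fin b → ℂ)) : 𝒪 b →ₐ[ℂ] 𝒪 a :=
  pullback F (F.analyticAt 0) (map_zero F)

theorem sub_killCoords_mem {n : ℕ} (p : Fin n) (g : 𝒪 n) :
    g - linearPullback (killCoords {p}) g ∈ Ideal.span {coord p} := by
  obtain ⟨f, hf, rfl⟩ := exists_holGerm_eq g
  obtain ⟨k, hk, e⟩ := exists_sub_update_eq_mul p hf
  rw [Ideal.mem_span_singleton]
  refine ⟨holGerm k hk, ?_⟩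
  refine Subtype.ext (Germ.coe_eq.2 ?_)
  filter_upwards [e] with x hx
  have : killCoords {p} x = Function.update x p 0 := by
    ext i
    rw [killCoords_apply, Function.update_apply]
    simp
  rw [← this] at hx
  exact hx

/-- The maximal ideal of `𝒪_S` is generated by the coordinates. -/
theorem maximalIdeal_eq_span {n : ℕ} :
    maximalIdeal (𝒪 n) = Ideal.span (Set.range (coord (n := n))) := by
  apply le_antisymm
  · intro g hg
    rw [mem_maximalIdeal_iff] at hg
    have main : ∀ s : Finset (Fin n), g - linearPullback (killCoords s) g ∈
        Ideal.span (Set.range (coord (n := n))) := by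
      intro s
      induction s using Finset.induction_on with
      | empty =>
        obtain ⟨f, hf, rfl⟩ := exists_holGerm_eq g
        have : linearPullback (killCoords (∅ : Finset (Fin n))) (holGerm f hf) = holGerm f hf := by
          refine Subtype.ext (Germ.coe_eq.2 (Eventually.of_forall fun x => ?_))
          change f (killCoords ∅ x) = f x
          congr 1
        rw [this, sub_self]
        exact zero_mem _
      | insert p s hp ih =>
        have e : linearPullback (killCoords (insert p s)) g =
            linearPullback (killCoords {p}) (linearPullback (killCoords s) g) := by
          obtain ⟨f, hf, rfl⟩ := exists_holGerm_eq g
          refine Subtype.ext (Germ.coe_eq.2 (Eventually.of_forall fun x => ?_))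
          change f (killCoords (insert p s) x) = f (killCoords s (killCoords {p} x))
          congr 1
          ext i
          simp only [killCoords_apply, Finset.mem_insert, Finset.mem_singleton]
          split_ifs <;> simp_all
        rw [e, ← sub_add_sub_cancel g (linearPullback (killCoords s) g)]
        refine add_mem ih (Ideal.span_mono ?_ (sub_killCoords_mem p _))
        rintro _ rfl
        exact ⟨p, rfl⟩
    have h := main Finset.univ
    have h0 : linearPullback (killCoords (Finset.univ : Finset (Fin n))) g = 0 := by
      obtain ⟨f, hf, rfl⟩ := exists_holGerm_eq g
      refine Subtype.ext (Germ.coe_eq.2 (Eventually.of_forall fun x => ?_))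
      change f (killCoords Finset.univ x) = 0
      rw [← hg, value₀_holGerm]
      congr 1
      ext i
      simp [killCoords_apply]
    rwa [h0, sub_zero] at h
  · rw [Ideal.span_le]
    rintro _ ⟨i, rfl⟩
    exact coord_mem i

/-- **Hadamard's lemma.** -/
theorem exists_eq_sum_coord_mul {n : ℕ} {f : 𝒪 n} (hf : value₀ f = 0) :
    ∃ g : Fin n → 𝒪 n, f = ∑ i, coord i * g i := by
  have := (mem_maximalIdeal_iff f).2 hf
  rw [maximalIdeal_eq_span, Ideal.mem_span_range_iff_exists_fun] at this
  obtain ⟨c, hc⟩ := this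
  exact ⟨c, by rw [← hc]; exact Finset.sum_congr rfl fun i _ => mul_comm _ _⟩

theorem sub_algebraMap_value₀_mem {n : ℕ} (f : 𝒪 n) :
    f - algebraMap ℂ (𝒪 n) (value₀ f) ∈ maximalIdeal (𝒪 n) := by
  rw [mem_maximalIdeal_iff, ← valueHom_apply, map_sub, AlgHom.commutes]
  exact sub_self _

/-! ### Orders of vanishing -/

/-- The vector field with constant coefficients `e`. -/
def constField {n : ℕ} (e : Fin n → ℂ) : Θ n := ∑ i, e i • pd i

theorem derivation_sum_apply {n : ℕ} {ι : Type*} (s : Finset ι) (D : ι → Θ n) (f : 𝒪 n) :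
    (∑ i ∈ s, D i) f = ∑ i ∈ s, D i f := by
  classical
  induction s using Finset.induction_on with
  | empty => simp
  | insert a s ha ih => rw [Finset.sum_insert ha, Finset.sum_insert ha, Derivation.add_apply, ih]

theorem constField_apply {n : ℕ} (e : Fin n → ℂ) (f : 𝒪 n) :
    constField e f = ∑ i, e i • pd i f := by
  rw [constField, derivation_sum_apply]
  rfl

theorem exists_constField_holGerm {n : ℕ} (e : Fin n → ℂ) {f : (Fin n → ℂ) → ℂ}
    (hf : AnalyticAt ℂ f 0) : ∃ h : AnalyticAt ℂ (fun x => fderiv ℂ f x e) 0,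
    constField e (holGerm f hf) = holGerm (fun x => fderiv ℂ f x e) h := by
  have h : AnalyticAt ℂ (fun x => fderiv ℂ f x e) 0 :=
    ((ContinuousLinearMap.apply ℂ ℂ e).analyticAt _).comp (AnalyticAt.fderiv hf)
  refine ⟨h, ?_⟩
  have hi : ∀ i : Fin n, AnalyticAt ℂ (fun x => fderiv ℂ f x (Pi.single i 1)) 0 := fun i =>
    ((ContinuousLinearMap.apply ℂ ℂ (Pi.single i 1 : Fin n → ℂ)).analyticAt _).comp
      (AnalyticAt.fderiv hf)
  have key : ∀ s : Finset (Fin n), ∃ hs : AnalyticAt ℂ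
      (fun x => ∑ i ∈ s, e i • fderiv ℂ f x (Pi.single i 1)) 0,
      ∑ i ∈ s, e i • pd i (holGerm f hf) =
        holGerm (fun x => ∑ i ∈ s, e i • fderiv ℂ f x (Pi.single i 1)) hs := by
    intro s
    induction s using Finset.induction_on with
    | empty =>
      refine ⟨by simpa using analyticAt_const, ?_⟩
      simp only [Finset.sum_empty]
      rfl
    | insert a s ha ih =>
      obtain ⟨hs, e'⟩ := ih
      simp only [Finset.sum_insert ha]
      refine ⟨((hi a).const_smul (c := e a)).add hs, ?_⟩
      rw [e']
      rfl
  obtain ⟨hs, e'⟩ := key Finset.univ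
  rw [constField_apply, e', holGerm_eq_iff]
  refine Eventually.of_forall fun x => ?_
  change ∑ i, e i • fderiv ℂ f x (Pi.single i 1) = fderiv ℂ f x e
  conv_rhs => rw [pi_eq_sum_univ' e, map_sum]
  exact Finset.sum_congr rfl fun i _ => by rw [map_smul]

/-- Reduces orders of vanishing to one complex variable: differentiating along a constant field is
differentiating the restriction to the line `t • e`. -/
theorem value₀_iterate_constField {n : ℕ} (e : Fin n → ℂ) (d : ℕ) :
    ∀ {f : (Fin n → ℂ) → ℂ} (hf : AnalyticAt ℂ f 0),
    value₀ ((constField e)^[d] (holGerm f hf)) = iteratedDeriv d (fun t : ℂ => f (t • e)) 0 := by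
  induction d with
  | zero =>
    intro f hf
    simp [value₀_holGerm]
  | succ d ih =>
    intro f hf
    obtain ⟨h, he⟩ := exists_constField_holGerm e hf
    rw [Function.iterate_succ_apply, he, ih h, iteratedDeriv_succ']
    apply Filter.EventuallyEq.iteratedDeriv_eq
    have hc : Tendsto (fun t : ℂ => t • e) (𝓝 0) (𝓝 0) := by
      have : Continuous fun t : ℂ => t • e := by fun_prop
      simpa using this.tendsto 0
    filter_upwards [hc.eventually hf.eventually_analyticAt] with t ht
    have h1 : HasDerivAt (fun t : ℂ => t • e) e t := by
      simpa using (hasDerivAt_id t).smul_const e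
    exact (ht.differentiableAt.hasFDerivAt.comp_hasDerivAt t h1).deriv.symm

/-- A nonzero germ has a nonvanishing iterated derivative in some direction. -/
theorem exists_value₀_iterate_constField_ne_zero {n : ℕ} {f : 𝒪 n} (hf : f ≠ 0) :
    ∃ (e : Fin n → ℂ) (d : ℕ), value₀ ((constField e)^[d] f) ≠ 0 := by
  by_contra! H
  obtain ⟨f, hf', rfl⟩ := exists_holGerm_eq f
  apply hf
  obtain ⟨r, hr, hball⟩ := Metric.eventually_nhds_iff_ball.1 hf'.eventually_analyticAt
  refine Subtype.ext (Germ.coe_eq.2 (Filter.eventually_of_mem (Metric.ball_mem_nhds 0 hr) ?_))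
  intro e he
  -- The parameter set is convex and contains `0` and `1`, so the one-variable identity theorem
  -- carries the vanishing at `t = 0` to the point `e`.
  set U : Set ℂ := (fun t : ℂ => t • e) ⁻¹' Metric.ball 0 r with hU
  have hUan : AnalyticOnNhd ℂ (fun t : ℂ => f (t • e)) U := by
    intro t ht
    exact (hball _ ht).comp (f := fun t : ℂ => t • e)
      (((ContinuousLinearMap.id ℂ ℂ).smulRight e).analyticAt t)
  have hUc : IsPreconnected U := by
    have : Convex ℝ U := by
      have hl : IsLinearMap ℝ (fun t : ℂ => t • e) :=
        ⟨fun x y => add_smul x y e, fun c x => smul_assoc c x e⟩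
      exact (convex_ball (0 : Fin n → ℂ) r).is_linear_preimage hl
    exact this.isPreconnected
  have h0 : (0 : ℂ) ∈ U := by simp [hU, hr]
  have h1 : (1 : ℂ) ∈ U := by simpa [hU] using he
  have hz : (fun t : ℂ => f (t • e)) =ᶠ[𝓝 0] 0 := by
    have := (hUan 0 h0).hasFPowerSeriesAt
    have hc : (fun n : ℕ => iteratedDeriv n (fun t : ℂ => f (t • e)) 0 / (n.factorial : ℂ)) = 0 := by
      funext k
      rw [← value₀_iterate_constField e k hf', H, zero_div]
      rfl
    rw [hc] at this
    have h2 : FormalMultilinearSeries.ofScalars ℂ (0 : ℕ → ℂ) = 0 := by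
      ext k
      simp [FormalMultilinearSeries.ofScalars]
    rw [h2] at this
    exact this.eventually_eq_zero
  have := hUan.eqOn_zero_of_preconnected_of_eventuallyEq_zero hUc h0 hz h1
  simpa using this

theorem derivation_mem_pow {R A : Type*} [CommRing R] [CommRing A] [Algebra R A]
    (D : Derivation R A A) (I : Ideal A) (k : ℕ) :
    ∀ {x : A}, x ∈ I ^ (k + 1) → D x ∈ I ^ k := by
  induction k with
  | zero => intro x _; simp
  | succ k ih =>
    intro x hx
    rw [pow_succ] at hx
    induction hx using Submodule.mul_induction_on' with
    | mem_mul_mem a ha b hb =>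
      rw [Derivation.leibniz, smul_eq_mul, smul_eq_mul]
      refine add_mem (Ideal.mul_mem_right _ _ ha) ?_
      rw [pow_succ']
      exact Ideal.mul_mem_mul hb (ih ha)
    | add a _ b _ h1 h2 => rw [map_add]; exact add_mem h1 h2

theorem iterate_derivation_mem_pow {R A : Type*} [CommRing R] [CommRing A] [Algebra R A]
    (D : Derivation R A A) (I : Ideal A) (k d : ℕ) :
    ∀ {x : A}, x ∈ I ^ (k + d) → D^[d] x ∈ I ^ k := by
  induction d with
  | zero => intro x hx; exact hx
  | succ d ih =>
    intro x hx
    rw [Function.iterate_succ_apply]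
    exact ih (derivation_mem_pow D I _ hx)

/-- Krull's intersection theorem by differentiation: `d` derivatives carry `𝔪 ^ (1 + d)` into `𝔪`,
while a nonzero germ has some iterated derivative with nonzero value. -/
theorem eq_zero_of_forall_mem_pow {n : ℕ} {f : 𝒪 n} (hf : ∀ k, f ∈ maximalIdeal (𝒪 n) ^ k) :
    f = 0 := by
  by_contra h
  obtain ⟨e, d, hd⟩ := exists_value₀_iterate_constField_ne_zero h
  apply hd
  rw [← mem_maximalIdeal_iff]
  simpa using iterate_derivation_mem_pow (constField e) (maximalIdeal (𝒪 n)) 1 d (hf (1 + d))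

/-- A proper ideal of `𝒪_S` which is stable under all vector fields is zero. -/
theorem eq_bot_of_derivation_stable {n : ℕ} {I : Ideal (𝒪 n)} (hI : I ≠ ⊤)
    (hD : ∀ D : Θ n, ∀ f ∈ I, D f ∈ I) : I = ⊥ := by
  rw [eq_bot_iff]
  intro f hf
  by_contra h
  obtain ⟨e, d, hd⟩ := exists_value₀_iterate_constField_ne_zero h
  apply hd
  rw [← mem_maximalIdeal_iff]
  refine le_maximalIdeal hI ?_
  clear hd
  induction d with
  | zero => exact hf
  | succ d ih =>
    rw [Function.iterate_succ_apply']
    exact hD _ _ ih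

/-! ### The chain rule -/

/-- A germ minus a constant other than its value is a unit, and units map to units. Hence every
algebra homomorphism is local, with no continuity assumed. -/
theorem value₀_algHom {n m : ℕ} (π : 𝒪 n →ₐ[ℂ] 𝒪 m) (f : 𝒪 n) : value₀ (π f) = value₀ f := by
  by_contra h
  have h1 : IsUnit (π f - algebraMap ℂ _ (value₀ (π f)) - (π f - algebraMap ℂ _ (value₀ f))) := by
    rw [isUnit_iff_value_ne_zero, ← valueHom_apply]
    simp only [map_sub, AlgHom.commutes, valueHom_apply]
    simpa [sub_eq_zero] using Ne.symm h
  have h2 : IsUnit (f - algebraMap ℂ _ (value₀ (π f))) := by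
    rw [isUnit_iff_value_ne_zero, ← valueHom_apply, map_sub, AlgHom.commutes, valueHom_apply]
    exact sub_ne_zero.2 (Ne.symm h)
  have h3 := h2.map π
  rw [map_sub, AlgHom.commutes, isUnit_iff_value_ne_zero, ← valueHom_apply, map_sub,
    AlgHom.commutes] at h3
  exact h3 (sub_self _)

theorem algHom_mem_maximalIdeal {n m : ℕ} (π : 𝒪 n →ₐ[ℂ] 𝒪 m) {f : 𝒪 n} :
    π f ∈ maximalIdeal (𝒪 m) ↔ f ∈ maximalIdeal (𝒪 n) := by
  rw [mem_maximalIdeal_iff, mem_maximalIdeal_iff, value₀_algHom]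

/-- The chain rule for homomorphisms of analytic algebras. -/
theorem derivation_algHom_apply {n m : ℕ} (π : 𝒪 n →ₐ[ℂ] 𝒪 m) (D : Θ m) (f : 𝒪 n) :
    D (π f) = ∑ i, D (π (coord i)) * π (pd i f) := by
  -- The defect `F` is a derivation along `π` that kills constants and coordinates. Each use of
  -- Hadamard's lemma extracts one factor from `𝔪`, so `F g` lies in every power of `𝔪`.
  let F : 𝒪 n →ₗ[ℂ] 𝒪 m := D.toLinearMap ∘ₗ π.toLinearMap -
    ∑ i, LinearMap.mulLeft ℂ (D (π (coord i))) ∘ₗ π.toLinearMap ∘ₗ (pd i).toLinearMap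
  have hF : ∀ g, F g = D (π g) - ∑ i, D (π (coord i)) * π (pd i g) := by
    intro g
    simp [F, LinearMap.sum_apply]
  have hc : ∀ c : ℂ, F (algebraMap ℂ _ c) = 0 := by
    intro c
    simp [hF]
  have hX : ∀ j, F (coord j) = 0 := by
    intro j
    simp [hF, pd_coord]
  have hmul : ∀ a b, F (a * b) = π a * F b + π b * F a := by
    intro a b
    simp only [hF, map_mul, Derivation.leibniz, smul_eq_mul, map_add, mul_add,
      Finset.sum_add_distrib, mul_sub, Finset.mul_sum]
    rw [Finset.sum_congr rfl fun i _ => mul_left_comm (D (π (coord i))) (π a) (π (pd i b)),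
      Finset.sum_congr rfl fun i _ => mul_left_comm (D (π (coord i))) (π b) (π (pd i a))]
    ring
  have hN : ∀ N g, F g ∈ maximalIdeal (𝒪 m) ^ N := by
    intro N
    induction N with
    | zero => intro g; simp
    | succ N ih =>
      intro g
      have h0 : value₀ (g - algebraMap ℂ _ (value₀ g)) = 0 :=
        (mem_maximalIdeal_iff _).1 (sub_algebraMap_value₀_mem g)
      obtain ⟨k, hk⟩ := exists_eq_sum_coord_mul h0
      have : F g = ∑ i, π (coord i) * F (k i) := by
        rw [← sub_zero (F g), ← hc (value₀ g), ← map_sub, hk, map_sum]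
        refine Finset.sum_congr rfl fun i _ => ?_
        rw [hmul, hX, mul_zero, add_zero]
      rw [this, pow_succ']
      exact sum_mem fun i _ =>
        Ideal.mul_mem_mul ((algHom_mem_maximalIdeal π).2 (coord_mem i)) (ih _)
  exact sub_eq_zero.1 ((hF f).symm.trans (eq_zero_of_forall_mem_pow fun N => hN N f))

theorem derivation_apply {n : ℕ} (D : Θ n) (f : 𝒪 n) : D f = ∑ i, D (coord i) * pd i f :=
  derivation_algHom_apply (AlgHom.id ℂ _) D f

theorem derivation_ext_coord {n : ℕ} {D D' : Θ n} (h : ∀ i, D (coord i) = D' (coord i)) :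
    D = D' := by
  ext f
  rw [derivation_apply D, derivation_apply D']
  simp only [h]

/-- The vector field with given coefficients. -/
def vecField {n : ℕ} (c : Fin n → 𝒪 n) : Θ n := ∑ i, c i • pd i

theorem vecField_apply {n : ℕ} (c : Fin n → 𝒪 n) (f : 𝒪 n) :
    vecField c f = ∑ i, c i * pd i f := by
  rw [vecField, derivation_sum_apply]
  rfl

theorem vecField_coord {n : ℕ} (c : Fin n → 𝒪 n) (i : Fin n) : vecField c (coord i) = c i := by
  simp [vecField_apply, pd_coord]

/-! ### Straightening smooth hypersurfaces -/

/-- The inclusion of the hyperplane `xₚ = 0`. -/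
def hyperplaneIncl {m : ℕ} (p : Fin (m + 1)) : (Fin m → ℂ) →L[ℂ] (Fin (m + 1) → ℂ) :=
  LinearMap.toContinuousLinearMap
    { toFun := fun x => p.insertNth (0 : ℂ) x
      map_add' := fun x y => by
        ext i
        rcases p.eq_self_or_eq_succAbove i with rfl | ⟨j, rfl⟩ <;> simp
      map_smul' := fun c x => by
        ext i
        rcases p.eq_self_or_eq_succAbove i with rfl | ⟨j, rfl⟩ <;> simp }

/-- The projection forgetting the coordinate `xₚ`. -/
def hyperplaneProj {m : ℕ} (p : Fin (m + 1)) : (Fin (m + 1) → ℂ) →L[ℂ] (Fin m → ℂ) :=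
  ContinuousLinearMap.pi fun i => ContinuousLinearMap.proj (R := ℂ)
    (φ := fun _ : Fin (m + 1) => ℂ) (p.succAbove i)

theorem hyperplaneProj_incl {m : ℕ} (p : Fin (m + 1)) (x : Fin m → ℂ) :
    hyperplaneProj p (hyperplaneIncl p x) = x := by
  ext i
  simp [hyperplaneProj, hyperplaneIncl]

theorem hyperplaneIncl_proj {m : ℕ} (p : Fin (m + 1)) (x : Fin (m + 1) → ℂ) :
    hyperplaneIncl p (hyperplaneProj p x) = killCoords {p} x := by
  ext i
  rw [killCoords_apply]
  rcases p.eq_self_or_eq_succAbove i with rfl | ⟨j, rfl⟩ <;>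
    simp [hyperplaneProj, hyperplaneIncl]

/-- Replacing the coordinate `xₚ` by `f` is a change of coordinates if `∂f/∂xₚ` does not vanish. -/
theorem exists_algEquiv_coord_eq {n : ℕ} (p : Fin n) {f : 𝒪 n} (h0 : value₀ f = 0)
    (h1 : value₀ (pd p f) ≠ 0) : ∃ Φ : 𝒪 n ≃ₐ[ℂ] 𝒪 n, Φ (coord p) = f := by
  obtain ⟨f, hf, rfl⟩ := exists_holGerm_eq f
  rw [value₀_holGerm] at h0
  change fderiv ℂ f 0 (Pi.single p 1) ≠ 0 at h1
  let e : Fin n → ℂ := Pi.single p 1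
  -- The map with `p`-th component `f` and all other components unchanged; its derivative at `0` is
  -- injective because `∂f/∂xₚ` is nonzero there.
  let F : (Fin n → ℂ) → (Fin n → ℂ) := fun x => x + (f x - x p) • e
  let pr : (Fin n → ℂ) →L[ℂ] ℂ := ContinuousLinearMap.proj (R := ℂ) (φ := fun _ : Fin n => ℂ) p
  let L : (Fin n → ℂ) →L[ℂ] (Fin n → ℂ) :=
    ContinuousLinearMap.id ℂ _ + (fderiv ℂ f 0 - pr).smulRight e
  have hL : ∀ v, L v = v + (fderiv ℂ f 0 v - v p) • e := fun v => rfl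
  have hFan : AnalyticAt ℂ F 0 :=
    analyticAt_id.add ((hf.sub (pr.analyticAt 0)).smul analyticAt_const)
  have hF0 : F 0 = 0 := by simp [F, h0]
  have hFL : HasFDerivAt F L 0 :=
    (hasFDerivAt_id 0).add ((hf.differentiableAt.hasFDerivAt.sub pr.hasFDerivAt).smul_const e)
  have hinj : Function.Injective L := by
    rw [injective_iff_map_eq_zero]
    intro v hv
    rw [hL] at hv
    have hvi : ∀ i, i ≠ p → v i = 0 := by
      intro i hi
      simpa [e, hi] using congrFun hv i
    have hvp : fderiv ℂ f 0 v = 0 := by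
      simpa [e] using congrFun hv p
    have hve : v = v p • e := by
      ext i
      rcases eq_or_ne i p with rfl | hi
      · simp [e]
      · simp [e, hi, hvi i hi]
    rw [hve, map_smul, smul_eq_mul] at hvp
    rw [hve, (mul_eq_zero.1 hvp).resolve_right h1, zero_smul]
  let i : (Fin n → ℂ) ≃L[ℂ] (Fin n → ℂ) :=
    (LinearEquiv.ofInjectiveEndo (L : (Fin n → ℂ) →ₗ[ℂ] (Fin n → ℂ)) hinj).toContinuousLinearEquiv
  have hi : (i : (Fin n → ℂ) →L[ℂ] (Fin n → ℂ)) = L := by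
    ext v
    rfl
  have hs : HasStrictFDerivAt F (i : (Fin n → ℂ) →L[ℂ] (Fin n → ℂ)) 0 := by
    rw [hi, ← hFL.fderiv]
    exact hFan.hasStrictFDerivAt
  let G := hs.localInverse F i 0
  have hG0 : G 0 = 0 := by
    have := hs.localInverse_apply_image
    rwa [hF0] at this
  have hGan : AnalyticAt ℂ G 0 := by
    have hmem : (0 : Fin n → ℂ) ∈ (hs.toOpenPartialHomeomorph F).target := by
      have := hs.image_mem_toOpenPartialHomeomorph_target
      rwa [hF0] at this
    have hG0' : (hs.toOpenPartialHomeomorph F).symm 0 = 0 := hG0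
    refine (hs.toOpenPartialHomeomorph F).analyticAt_symm (i := i) hmem ?_ ?_
    · rw [hG0']
      exact hFan
    · rw [hG0']
      exact hs.hasFDerivAt.fderiv
  have hGF : ∀ᶠ x in 𝓝 0, G (F x) = x := hs.eventually_left_inverse
  have hFG : ∀ᶠ x in 𝓝 0, F (G x) = x := by
    have := hs.eventually_right_inverse
    rwa [hF0] at this
  refine ⟨AlgEquiv.ofAlgHom (pullback F hFan hF0) (pullback G hGan hG0) ?_ ?_, ?_⟩
  · ext1 g
    obtain ⟨g, hg, rfl⟩ := exists_holGerm_eq g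
    refine Subtype.ext (Germ.coe_eq.2 ?_)
    filter_upwards [hGF] with x hx
    exact congrArg g hx
  · ext1 g
    obtain ⟨g, hg, rfl⟩ := exists_holGerm_eq g
    refine Subtype.ext (Germ.coe_eq.2 ?_)
    filter_upwards [hFG] with x hx
    exact congrArg g hx
  · refine Subtype.ext (Germ.coe_eq.2 (Eventually.of_forall fun x => ?_))
    change F x p = f x
    simp [F, e]

/-- **Implicit function theorem**: a germ with a nonvanishing partial derivative defines a smooth
hypersurface. -/
theorem exists_surjective_ker_eq_span {m : ℕ} (p : Fin (m + 1)) {f : 𝒪 (m + 1)}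
    (h0 : value₀ f = 0) (h1 : value₀ (pd p f) ≠ 0) :
    ∃ π : 𝒪 (m + 1) →ₐ[ℂ] 𝒪 m, Function.Surjective π ∧ ∀ g, π g = 0 ↔ g ∈ Ideal.span {f} := by
  obtain ⟨Φ, hΦ⟩ := exists_algEquiv_coord_eq p h0 h1
  have hip : ∀ g : 𝒪 m, linearPullback (hyperplaneIncl p) (linearPullback (hyperplaneProj p) g)
      = g := by
    intro g
    obtain ⟨g, hg, rfl⟩ := exists_holGerm_eq g
    refine Subtype.ext (Germ.coe_eq.2 (Eventually.of_forall fun x => ?_))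
    exact congrArg g (hyperplaneProj_incl p x)
  have hpi : ∀ g : 𝒪 (m + 1), linearPullback (hyperplaneProj p)
      (linearPullback (hyperplaneIncl p) g) = linearPullback (killCoords {p}) g := by
    intro g
    obtain ⟨g, hg, rfl⟩ := exists_holGerm_eq g
    refine Subtype.ext (Germ.coe_eq.2 (Eventually.of_forall fun x => ?_))
    exact congrArg g (hyperplaneIncl_proj p x)
  refine ⟨(linearPullback (hyperplaneIncl p)).comp Φ.symm.toAlgHom, fun g => ?_, fun g => ?_⟩
  · exact ⟨Φ (linearPullback (hyperplaneProj p) g), by simpa using hip g⟩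
  · change linearPullback (hyperplaneIncl p) (Φ.symm g) = 0 ↔ _
    rw [Ideal.mem_span_singleton, ← hΦ]
    constructor
    · intro h
      have h2 := hpi (Φ.symm g)
      rw [h, map_zero] at h2
      have h3 := sub_killCoords_mem p (Φ.symm g)
      rw [← h2, sub_zero, Ideal.mem_span_singleton] at h3
      simpa using map_dvd Φ h3
    · rintro ⟨k, rfl⟩
      rw [map_mul, AlgEquiv.symm_apply_apply, map_mul]
      have : linearPullback (hyperplaneIncl p) (coord p) = 0 := by
        refine Subtype.ext (Germ.coe_eq.2 (Eventually.of_forall fun x => ?_))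
        change (hyperplaneIncl p x) p = 0
        simp [hyperplaneIncl]
      rw [this, zero_mul]

/-! ### Derivations and minimal primes -/

/-- Localizing the reduced ring `A / I` at a minimal prime gives a field. Concretely, if no such `s`
existed, a prime over `I` avoiding both the complement of `P` and the powers of `x` would be
strictly smaller than `P`. -/
theorem exists_notMem_mul_mem_of_mem_minimalPrimes {A : Type*} [CommRing A] {I P : Ideal A}
    (hI : I.IsRadical) (hP : P ∈ I.minimalPrimes) {x : A} (hx : x ∈ P) :
    ∃ s, s ∉ P ∧ s * x ∈ I := by
  by_contra! H
  have hPp : P.IsPrime := hP.1.1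
  let S : Submonoid A := P.primeCompl ⊔ Submonoid.powers x
  have hS : Disjoint (I : Set A) (S : Set A) := by
    rw [Set.disjoint_left]
    intro y hy hyS
    obtain ⟨s, hs, t, ht, rfl⟩ := Submonoid.mem_sup.1 hyS
    obtain ⟨k, rfl⟩ := ht
    refine H s hs (hI ⟨k + 1, ?_⟩)
    have : (s * x) ^ (k + 1) = (s * x ^ k) * (s ^ k * x) := by ring
    rw [this]
    exact I.mul_mem_right _ hy
  obtain ⟨Q, hQ, hIQ, hdis⟩ := Ideal.exists_le_prime_disjoint I S hS
  have hQP : Q ≤ P := by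
    intro y hy
    by_contra hyP
    exact Set.disjoint_left.1 hdis hy (Submonoid.mem_sup_left (show y ∈ P.primeCompl from hyP))
  have hxQ : x ∈ Q := hP.2 ⟨hQ, hIQ⟩ hQP hx
  exact Set.disjoint_left.1 hdis hxQ (Submonoid.mem_sup_right (Submonoid.mem_powers x))

/-- A minimal prime of a radical principal ideal `(h)` which contains `D h` is stable under `D`. -/
theorem derivation_mem_of_mem_minimalPrimes {R A : Type*} [CommRing R] [CommRing A] [Algebra R A]
    {h : A} {P : Ideal A} (hI : (Ideal.span {h}).IsRadical) (hP : P ∈ (Ideal.span {h}).minimalPrimes)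
    (D : Derivation R A A) (hD : D h ∈ P) {f : A} (hf : f ∈ P) : D f ∈ P := by
  have hPp : P.IsPrime := hP.1.1
  have hh : h ∈ P := hP.1.2 (Ideal.mem_span_singleton_self h)
  obtain ⟨s, hs, hsf⟩ := exists_notMem_mul_mem_of_mem_minimalPrimes hI hP hf
  obtain ⟨u, hu⟩ := Ideal.mem_span_singleton'.1 hsf
  have h1 := congrArg D hu
  simp only [Derivation.leibniz, smul_eq_mul] at h1
  have h2 : s * D f = u * D h + h * D u - f * D s := by rw [h1]; ring
  have h3 : s * D f ∈ P := by
    rw [h2]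
    exact P.sub_mem (P.add_mem (P.mul_mem_left _ hD) (P.mul_mem_right _ hh)) (P.mul_mem_right _ hf)
  exact (hPp.mem_or_mem h3).resolve_left hs

theorem mem_of_mul_mem_of_notMem_minimalPrimes {A : Type*} [CommRing A] {I : Ideal A}
    (hI : I.IsRadical) {g b : A} (hg : ∀ P ∈ I.minimalPrimes, g ∉ P) (hb : b * g ∈ I) : b ∈ I := by
  rw [← hI.radical, ← Ideal.sInf_minimalPrimes, Ideal.mem_sInf]
  intro P hP
  exact (hP.1.1.mem_or_mem (hP.1.2 hb)).resolve_right (hg P hP)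

theorem IsReducedEquation.isRadical {n : ℕ} {h : 𝒪 n} (hD : IsReducedEquation h) :
    (Ideal.span {h}).IsRadical :=
  (Ideal.isRadical_iff_quotient_reduced _).2 hD.isReduced

theorem IsReducedEquation.mem_maximalIdeal {n : ℕ} {h : 𝒪 n} (hD : IsReducedEquation h) :
    h ∈ maximalIdeal (𝒪 n) := (mem_maximalIdeal_iff h).2 hD.value_eq_zero

theorem IsReducedEquation.not_dvd_one {n : ℕ} {h : 𝒪 n} (hD : IsReducedEquation h) : ¬ h ∣ 1 :=
  fun h1 => (IsLocalRing.mem_maximalIdeal h).1 hD.mem_maximalIdeal (isUnit_of_dvd_one h1)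

/-- In a suitable direction, the derivative of a reduced equation is a non zero divisor on `D`. -/
theorem exists_constField_regular {n : ℕ} {h : 𝒪 n} (hD : IsReducedEquation h) :
    ∃ e : Fin n → ℂ, ∀ b, h ∣ b * constField e h → h ∣ b := by
  obtain ⟨e, d, hd⟩ := exists_value₀_iterate_constField_ne_zero hD.ne_zero
  refine ⟨e, fun b hb => ?_⟩
  rw [← Ideal.mem_span_singleton] at hb ⊢
  refine mem_of_mul_mem_of_notMem_minimalPrimes hD.isRadical (fun P hP hgP => ?_) hb
  -- A minimal prime containing the first derivative contains all of them, but the direction `e` was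
  -- chosen so that some iterated derivative is a unit.
  have hk : ∀ k, (constField e)^[k] h ∈ P := by
    intro k
    induction k with
    | zero => exact hP.1.2 (Ideal.mem_span_singleton_self h)
    | succ k ih =>
      rw [Function.iterate_succ_apply']
      exact derivation_mem_of_mem_minimalPrimes hD.isRadical hP _ hgP ih
  exact hP.1.1.ne_top (Ideal.eq_top_of_isUnit_mem _ (hk d) ((isUnit_iff_value_ne_zero _).2 hd))

theorem dvd_of_forall_dvd_mul_pd {n : ℕ} {h : 𝒪 n} (hD : IsReducedEquation h) {b : 𝒪 n}
    (hb : ∀ i, h ∣ b * pd i h) : h ∣ b := by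
  obtain ⟨e, he⟩ := exists_constField_regular hD
  apply he
  rw [constField_apply, Finset.mul_sum]
  refine Finset.dvd_sum fun i _ => ?_
  rw [mul_smul_comm]
  exact (hb i).trans ⟨algebraMap ℂ _ (e i), by rw [Algebra.smul_def, mul_comm]⟩

/-! ### Numerators of logarithmic forms -/

/-- The form `a / h`. -/
def divForm {n : ℕ} (h : 𝒪 n) (a : Fin n → 𝒪 n) : MerForm n := fun i =>
  algebraMap (𝒪 n) (Mer n) (a i) / algebraMap (𝒪 n) (Mer n) h

/-- The `1`-forms `a` such that `dh ∧ a` is divisible by `h`. -/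
def logNum {n : ℕ} (h : 𝒪 n) : Submodule (𝒪 n) (Fin n → 𝒪 n) where
  carrier := {a | ∀ i j, h ∣ pd i h * a j - pd j h * a i}
  add_mem' ha hb i j := by
    have := dvd_add (ha i j) (hb i j)
    refine this.trans (dvd_of_eq ?_)
    simp only [Pi.add_apply]
    ring
  zero_mem' i j := by simp
  smul_mem' c a ha i j := by
    refine ((ha i j).mul_left c).trans (dvd_of_eq ?_)
    simp only [Pi.smul_apply, smul_eq_mul]
    ring

theorem algebraMap_ne_zero {n : ℕ} {h : 𝒪 n} (hh : h ≠ 0) : algebraMap (𝒪 n) (Mer n) h ≠ 0 := by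
  simpa using (IsFractionRing.injective (𝒪 n) (Mer n)).ne hh

/-- By the quotient rule `d(a/h) = da/h - (dh ∧ a)/h²`, so only the last term can obstruct a simple
pole. -/
theorem divForm_mem_logForms_iff {n : ℕ} {h : 𝒪 n} (hh : h ≠ 0) (a : Fin n → 𝒪 n) :
    divForm h a ∈ logForms h ↔ a ∈ logNum h := by
  have hh' := algebraMap_ne_zero hh
  have hinj := IsFractionRing.injective (𝒪 n) (Mer n)
  have h1 : ∀ i, HasSimplePole h (divForm h a i) := fun i =>
    ⟨a i, by rw [divForm, mul_div_cancel₀ _ hh']⟩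
  have h2 : ∀ i j, algebraMap (𝒪 n) (Mer n) h * (algebraMap (𝒪 n) (Mer n) h *
      diffForm (divForm h a) i j) = algebraMap (𝒪 n) (Mer n)
        (h * (pd i (a j) - pd j (a i)) - (pd i h * a j - pd j h * a i)) := by
    intro i j
    simp only [diffForm, divForm]
    rw [merPd_div i _ _ hh, merPd_div j _ _ hh]
    simp only [map_sub, map_mul]
    field_simp
    ring
  constructor
  · rintro ⟨-, H⟩ i j
    obtain ⟨f, hf⟩ := H i j
    have h3 := h2 i j
    rw [hf, ← map_mul] at h3
    refine ⟨pd i (a j) - pd j (a i) - f, ?_⟩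
    linear_combination hinj h3
  · intro H
    refine ⟨h1, fun i j => ?_⟩
    obtain ⟨k, hk⟩ := H i j
    refine ⟨pd i (a j) - pd j (a i) - k, mul_left_cancel₀ hh' ?_⟩
    rw [h2, hk, ← map_mul]
    congr 1
    ring

theorem divForm_injective {n : ℕ} {h : 𝒪 n} (hh : h ≠ 0) :
    Function.Injective (divForm h) := by
  intro a b hab
  ext1 i
  have := congrFun hab i
  simp only [divForm] at this
  exact IsFractionRing.injective (𝒪 n) (Mer n) (by
    simpa [div_left_inj' (algebraMap_ne_zero hh)] using this)

theorem exists_eq_divForm {n : ℕ} {h : 𝒪 n} (hh : h ≠ 0) {ω : MerForm n} (hω : ω ∈ logForms h) :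
    ∃ a ∈ logNum h, divForm h a = ω := by
  choose a ha using hω.1
  have : divForm h a = ω := by
    ext1 i
    rw [divForm, ← ha, mul_div_cancel_left₀ _ (algebraMap_ne_zero hh)]
  exact ⟨a, (divForm_mem_logForms_iff hh a).1 (this ▸ hω), this⟩

/-- Logarithmic forms and their numerators. -/
def logEquiv {n : ℕ} {h : 𝒪 n} (hh : h ≠ 0) : logNum h ≃ₗ[𝒪 n] logForms h :=
  LinearEquiv.ofBijective
    { toFun := fun a => ⟨divForm h a, (divForm_mem_logForms_iff hh _).2 a.2⟩
      map_add' := fun a b => by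
        ext i
        simp [divForm, add_div]
      map_smul' := fun c a => by
        ext i
        simp [divForm, Algebra.smul_def, mul_div_assoc] }
    ⟨fun a b hab => Subtype.ext (divForm_injective hh (congrArg Subtype.val hab)), fun ω => by
      obtain ⟨a, ha, e⟩ := exists_eq_divForm hh ω.2
      exact ⟨⟨a, ha⟩, Subtype.ext e⟩⟩

theorem coe_logEquiv {n : ℕ} {h : 𝒪 n} (hh : h ≠ 0) (a : logNum h) :
    (logEquiv hh a : MerForm n) = divForm h a := rfl

/-- The numerator `dh` of `dh/h`. -/
def dh {n : ℕ} (h : 𝒪 n) : logNum h :=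
  ⟨fun i => pd i h, fun i j => ⟨0, by ring⟩⟩

/-- Holomorphic forms, as logarithmic forms. -/
def holForm {n : ℕ} (h : 𝒪 n) : (Fin n → 𝒪 n) →ₗ[𝒪 n] logNum h where
  toFun η := ⟨fun i => h * η i, fun i j => ⟨pd i h * η j - pd j h * η i, by ring⟩⟩
  map_add' a b := by ext i; simp [mul_add]
  map_smul' c a := by ext i; simp [mul_left_comm]

theorem coe_dh {n : ℕ} (h : 𝒪 n) (i : Fin n) : (dh h : Fin n → 𝒪 n) i = pd i h := rfl

theorem coe_holForm {n : ℕ} (h : 𝒪 n) (η : Fin n → 𝒪 n) (i : Fin n) :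
    (holForm h η : Fin n → 𝒪 n) i = h * η i := rfl

/-! ### The residue map -/

theorem mk_mem_nonZeroDivisors_iff {n : ℕ} {h g : 𝒪 n} :
    Ideal.Quotient.mk (Ideal.span {h}) g ∈ (𝒪D h)⁰ ↔ ∀ b, h ∣ b * g → h ∣ b := by
  rw [mem_nonZeroDivisors_iff_right, Ideal.Quotient.mk_surjective.forall]
  refine forall_congr' fun b => ?_
  rw [← map_mul, Ideal.Quotient.eq_zero_iff_mem, Ideal.Quotient.eq_zero_iff_mem,
    Ideal.mem_span_singleton, Ideal.mem_span_singleton]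

theorem mk_eq_mk_iff {n : ℕ} {h a b : 𝒪 n} :
    Ideal.Quotient.mk (Ideal.span {h}) a = Ideal.Quotient.mk (Ideal.span {h}) b ↔ h ∣ a - b := by
  rw [Ideal.Quotient.eq, Ideal.mem_span_singleton]

theorem isResidue_divForm_iff {n : ℕ} {h : 𝒪 n} (hD : IsReducedEquation h) (a : Fin n → 𝒪 n)
    (r : MerD h) : IsResidue h (divForm h a) r ↔
      ∃ (g ξ : 𝒪 n) (hg : Ideal.Quotient.mk (Ideal.span {h}) g ∈ (𝒪D h)⁰),
        (∀ i, h ∣ g * a i - ξ * pd i h) ∧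
        r = IsLocalization.mk' (MerD h) (Ideal.Quotient.mk (Ideal.span {h}) ξ)
          (⟨Ideal.Quotient.mk (Ideal.span {h}) g, hg⟩ : (𝒪D h)⁰) := by
  have hh' := algebraMap_ne_zero hD.ne_zero
  have hinj := IsFractionRing.injective (𝒪 n) (Mer n)
  have key : ∀ g ξ η i, Ideal.Quotient.mk (Ideal.span {h}) g ∈ (𝒪D h)⁰ →
      (divForm h a i = dlog h i * (algebraMap (𝒪 n) (Mer n) ξ / algebraMap (𝒪 n) (Mer n) g) +
      algebraMap (𝒪 n) (Mer n) η / algebraMap (𝒪 n) (Mer n) g ↔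
        g * a i - ξ * pd i h = h * η) := by
    intro g ξ η i hg
    have hg0 : g ≠ 0 := by
      rintro rfl
      exact hD.not_dvd_one (mk_mem_nonZeroDivisors_iff.1 hg 1 (by simp))
    have hg' := algebraMap_ne_zero hg0
    rw [← hinj.eq_iff (a := g * a i - ξ * pd i h)]
    simp only [divForm, dlog, map_sub, map_mul]
    field_simp
    rw [sub_eq_iff_eq_add', eq_comm]
  constructor
  · rintro ⟨g, ξ, η, hg, e, rfl⟩
    exact ⟨g, ξ, hg, fun i => ⟨η i, (key g ξ (η i) i hg).1 (e i)⟩, rfl⟩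
  · rintro ⟨g, ξ, hg, e, rfl⟩
    choose η hη using e
    exact ⟨g, ξ, η, hg, fun i => (key g ξ (η i) i hg).2 (hη i), rfl⟩

/-- Logarithmic forms have unique residues, and the forms without residue are holomorphic. -/
theorem exists_residueMap {n : ℕ} {h : 𝒪 n} (hD : IsReducedEquation h) :
    ∃ ρ : logNum h →ₛₗ[Ideal.Quotient.mk (Ideal.span {h})] MerD h,
      (∀ (a : logNum h) (r : MerD h), IsResidue h (divForm h a) r ↔ r = ρ a) ∧
      ∀ a, ρ a = 0 → ∃ η, a = holForm h η := by
  obtain ⟨e, he⟩ := exists_constField_regular hD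
  set g := constField e h with hgdef
  have hg : Ideal.Quotient.mk (Ideal.span {h}) g ∈ (𝒪D h)⁰ := mk_mem_nonZeroDivisors_iff.2 he
  -- Contraction with the constant field `e`. Since `c(dh) = g` and `h` divides `dh ∧ a`, also `h`
  -- divides `g a - c(a) dh`, so the residue of `a / h` is `c(a) / g` with one denominator for all
  -- forms.
  let c : (Fin n → 𝒪 n) →ₗ[𝒪 n] 𝒪 n :=
    ∑ i, (algebraMap ℂ (𝒪 n) (e i)) • LinearMap.proj i
  have hc : ∀ a, c a = ∑ i, algebraMap ℂ (𝒪 n) (e i) * a i := by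
    intro a
    simp [c, LinearMap.sum_apply, Algebra.smul_def]
  have hg2 : g = ∑ i, algebraMap ℂ (𝒪 n) (e i) * pd i h := by
    rw [hgdef, constField_apply]
    exact Finset.sum_congr rfl fun i _ => Algebra.smul_def _ _
  let ρ : logNum h →ₛₗ[Ideal.Quotient.mk (Ideal.span {h})] MerD h :=
    { toFun := fun a => IsLocalization.mk' (MerD h) (Ideal.Quotient.mk (Ideal.span {h}) (c a))
          (⟨Ideal.Quotient.mk (Ideal.span {h}) g, hg⟩ : (𝒪D h)⁰)
      map_add' := fun a b => by
        rw [Submodule.coe_add, map_add, map_add, IsLocalization.mk'_eq_mul_mk'_one, map_add, add_mul,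
          ← IsLocalization.mk'_eq_mul_mk'_one, ← IsLocalization.mk'_eq_mul_mk'_one]
      map_smul' := fun x a => by
        rw [Submodule.coe_smul, map_smul, smul_eq_mul, map_mul]
        exact (IsLocalization.smul_mk' _ _ _).symm }
  have hdvd : ∀ a : logNum h, ∀ i, h ∣ g * (a : Fin n → 𝒪 n) i - c a * pd i h := by
    intro a i
    rw [hg2, hc, Finset.sum_mul, Finset.sum_mul, ← Finset.sum_sub_distrib]
    refine Finset.dvd_sum fun j _ => ?_
    refine ((a.2 j i).mul_left (algebraMap ℂ (𝒪 n) (e j))).trans (dvd_of_eq ?_)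
    ring
  refine ⟨ρ, fun a r => ?_, fun a ha => ?_⟩
  · rw [isResidue_divForm_iff hD]
    constructor
    · rintro ⟨g', ξ, hg', H, rfl⟩
      change _ = IsLocalization.mk' (MerD h) (Ideal.Quotient.mk (Ideal.span {h}) (c a))
          (⟨Ideal.Quotient.mk (Ideal.span {h}) g, hg⟩ : (𝒪D h)⁰)
      rw [IsLocalization.mk'_eq_iff_eq, ← map_mul, ← map_mul]
      congr 1
      rw [mk_eq_mk_iff]
      have : h ∣ c (g' • (a : Fin n → 𝒪 n)) - c (ξ • fun i => pd i h) := by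
        rw [hc, hc, ← Finset.sum_sub_distrib]
        refine Finset.dvd_sum fun i _ => ?_
        rw [← mul_sub]
        exact (H i).mul_left _
      rw [map_smul, map_smul, hc fun i => pd i h, ← hg2, smul_eq_mul, smul_eq_mul] at this
      rw [← dvd_neg]
      exact this.trans (dvd_of_eq (by ring))
    · rintro rfl
      exact ⟨g, c a, hg, hdvd a, rfl⟩
  · have h1 : h ∣ c a := by
      have := IsLocalization.mk'_eq_zero_iff (S := MerD h) (M := (𝒪D h)⁰)
        (Ideal.Quotient.mk (Ideal.span {h}) (c a)) ⟨Ideal.Quotient.mk (Ideal.span {h}) g, hg⟩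
      obtain ⟨m, hm⟩ := this.1 ha
      have := (mem_nonZeroDivisors_iff.1 m.2).1 _ hm
      rwa [Ideal.Quotient.eq_zero_iff_mem, Ideal.mem_span_singleton] at this
    have h2 : ∀ i, h ∣ (a : Fin n → 𝒪 n) i := by
      intro i
      apply he
      have := dvd_add (hdvd a i) (h1.mul_right (pd i h))
      rwa [sub_add_cancel, mul_comm] at this
    choose η hη using h2
    exact ⟨η, Subtype.ext (funext hη)⟩

/-! ### Members of bases and of minimal sets of generators over local rings -/

section LocalAlgebra

variable {R M : Type} [CommRing R] [IsLocalRing R] [AddCommGroup M] [Module R M]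

/-- The functional splits `M` as `R v ⊕ ker φ`, and the finite projective module `ker φ` is free
over the local ring. -/
theorem exists_basis_of_dual_eq_one [Module.Free R M] [Module.Finite R M] {v : M}
    (φ : M →ₗ[R] R) (hφ : φ v = 1) :
    ∃ (ι : Type) (b : Module.Basis ι R M) (i : ι), b i = v := by
  let K := LinearMap.ker φ
  let e : (R × K) ≃ₗ[R] M :=
    { toFun := fun x => x.1 • v + x.2
      map_add' := fun x y => by simp [add_smul]; abel
      map_smul' := fun c x => by simp [mul_smul]
      invFun := fun x => (φ x, ⟨x - φ x • v, by simp [K, hφ]⟩)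
      left_inv := fun x => by
        have := x.2.2
        rw [LinearMap.mem_ker] at this
        ext <;> simp [hφ, this]
      right_inv := fun x => by simp }
  let q : M →ₗ[R] K := LinearMap.snd R R K ∘ₗ e.symm.toLinearMap
  have hq : q ∘ₗ K.subtype = LinearMap.id := by
    ext x
    have hx := x.2
    rw [LinearMap.mem_ker] at hx
    change ((x : M) - φ x • v : M) = x
    rw [hx, zero_smul, sub_zero]
  have hproj : Module.Projective R K := Module.Projective.of_split K.subtype q hq
  have hfin : Module.Finite R K := Module.Finite.of_surjective q fun x =>
    ⟨x, LinearMap.congr_fun hq x⟩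
  have hfree : Module.Free R K := Module.free_of_flat_of_isLocalRing
  let c := Module.Free.chooseBasis R K
  refine ⟨_, ((Module.Basis.singleton Unit R).prod c).map e, Sum.inl (), ?_⟩
  simp [e]

theorem exists_dual_eq_one_of_notMem [Module.Free R M] {v : M}
    (hv : v ∉ maximalIdeal R • (⊤ : Submodule R M)) : ∃ φ : M →ₗ[R] R, φ v = 1 := by
  let b := Module.Free.chooseBasis R M
  by_contra! H
  apply hv
  have hc : ∀ i, b.repr v i ∈ maximalIdeal R := by
    intro i hu
    obtain ⟨u, hu⟩ := hu
    refine H ((↑u⁻¹ : R) • b.coord i) ?_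
    rw [LinearMap.smul_apply, Module.Basis.coord_apply, ← hu, smul_eq_mul, Units.inv_mul]
  rw [← b.linearCombination_repr v, Finsupp.linearCombination_apply]
  exact Submodule.sum_mem _ fun i _ => Submodule.smul_mem_smul (hc i) Submodule.mem_top

theorem dual_mem_maximalIdeal_of_mem {v : M} (hv : v ∈ maximalIdeal R • (⊤ : Submodule R M))
    (φ : M →ₗ[R] R) : φ v ∈ maximalIdeal R := by
  refine Submodule.smul_induction_on hv (fun c hc x _ => ?_) fun x y hx hy => ?_
  · rw [map_smul, smul_eq_mul]
    exact Ideal.mul_mem_right _ _ hc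
  · rw [map_add]
    exact add_mem hx hy

/-- Nakayama's lemma: a generator in `𝔪 • N` is redundant. Conversely, `x` together with the fewest
possible further generators is a minimal generating set, by an exchange argument. -/
theorem isPartOfMinimalGenerators_iff {N : Submodule R M} (hN : N.FG) {x : M} (hx : x ∈ N) :
    IsPartOfMinimalGenerators N x ↔ x ∉ maximalIdeal R • N := by
  classical
  constructor
  · rintro ⟨G, ⟨hG, hmin⟩, hxG⟩ hxm
    have hle : Submodule.span R (G \ {x}) ≤ N := hG ▸ Submodule.span_mono Set.sdiff_subset
    have h1 : N ≤ Submodule.span R (G \ {x}) := by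
      refine Submodule.le_of_le_smul_of_le_jacobson_bot hN
        (IsLocalRing.maximalIdeal_le_jacobson _) ?_
      conv_lhs => rw [← hG]
      rw [Submodule.span_le]
      intro y hy
      by_cases hyx : y = x
      · exact Submodule.mem_sup_right (hyx ▸ hxm)
      · exact Submodule.mem_sup_left (Submodule.subset_span ⟨hy, hyx⟩)
    have := hmin (le_antisymm hle h1) Set.sdiff_subset hxG
    exact this.2 rfl
  · intro hxm
    obtain ⟨s, hs⟩ := hN
    have hex : ∃ k, ∃ t : Finset M, t.card = k ∧ Submodule.span R (insert x (t : Set M)) = N := by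
      refine ⟨_, s, rfl, ?_⟩
      rw [Submodule.span_insert_eq_span (hs ▸ hx), hs]
    obtain ⟨t, htk, ht⟩ := Nat.find_spec hex
    have hmin : ∀ t' : Finset M, Submodule.span R (insert x (t' : Set M)) = N → t.card ≤ t'.card :=
      fun t' h' => htk ▸ Nat.find_min' hex ⟨t', rfl, h'⟩
    refine ⟨insert x (t : Set M), ⟨ht, fun G' hG' hle => ?_⟩, Set.mem_insert _ _⟩
    change Submodule.span R G' = N at hG'
    have hxt : x ∉ t := fun h => by
      have := hmin (t.erase x) (by rwa [← Finset.coe_insert, Finset.insert_erase h,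
        ← Set.insert_eq_of_mem (Finset.mem_coe.2 h)])
      exact absurd this (not_le.2 (Finset.card_erase_lt_of_mem h))
    have hxG : x ∈ G' := by
      by_contra hxG
      have hG't : G' ⊆ t := fun y hy => (hle hy).resolve_left fun h => hxG (h ▸ hy)
      have hxs : x ∈ Submodule.span R (t : Set M) := by
        have := hG' ▸ hx
        exact Submodule.span_mono hG't this
      obtain ⟨c, -, hc⟩ := Submodule.mem_span_finset.1 hxs
      -- As `x ∉ 𝔪 • N`, some coefficient is a unit; the corresponding `y` can be traded for `x`,
      -- against the minimality of `t`.
      have hun : ∃ y ∈ t, IsUnit (c y) := by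
        by_contra! H
        apply hxm
        rw [← hc]
        exact Submodule.sum_mem _ fun y hy => Submodule.smul_mem_smul (H y hy)
          (ht ▸ Submodule.subset_span (Set.mem_insert_of_mem _ hy))
      obtain ⟨y, hy, u, hu⟩ := hun
      have hye : y ∈ Submodule.span R (insert x ((t.erase y : Finset M) : Set M)) := by
        have h1 : c y • y = x - ∑ z ∈ t.erase y, c z • z := by
          rw [← hc, ← Finset.add_sum_erase t _ hy, add_sub_cancel_right]
        have h2 : y = (↑u⁻¹ : R) • (x - ∑ z ∈ t.erase y, c z • z) := by
          rw [← h1, ← hu, smul_smul, Units.inv_mul, one_smul]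
        refine (congrArg (· ∈ Submodule.span R (insert x ((t.erase y : Finset M) : Set M))) h2).mpr
          ?_
        refine Submodule.smul_mem _ _ (Submodule.sub_mem _
          (Submodule.subset_span (Set.mem_insert _ _)) (Submodule.sum_mem _ fun z hz => ?_))
        exact Submodule.smul_mem _ _ (Submodule.subset_span (Set.mem_insert_of_mem _ hz))
      have h3 : Submodule.span R (insert x ((t.erase y : Finset M) : Set M)) = N := by
        rw [← ht]
        refine le_antisymm (Submodule.span_mono (Set.insert_subset_insert ?_))
          (Submodule.span_le.2 ?_)
        · exact Finset.coe_subset.2 (Finset.erase_subset _ _)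
        · rintro z (rfl | hz)
          · exact Submodule.subset_span (Set.mem_insert _ _)
          · by_cases hzy : z = y
            · exact hzy ▸ hye
            · exact Submodule.subset_span
                (Set.mem_insert_of_mem _ (Finset.mem_coe.2 (Finset.mem_erase.2 ⟨hzy, hz⟩)))
      exact absurd (hmin _ h3) (not_le.2 (Finset.card_erase_lt_of_mem hy))
    have h4 : insert x ((t.filter (· ∈ G') : Finset M) : Set M) = G' := by
      ext y
      simp only [Set.mem_insert_iff, Finset.coe_filter, Set.mem_ofPred_eq]
      constructor
      · rintro (rfl | h)
        · exact hxG
        · exact h.2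
      · intro hy
        exact (hle hy).imp id fun h => ⟨h, hy⟩
    have h5 := hmin _ (by rw [h4, hG'])
    have h6 := Finset.eq_of_subset_of_card_le (Finset.filter_subset _ t) h5
    rintro y (rfl | hy)
    · exact hxG
    · rw [← h6] at hy
      exact (Finset.mem_filter.1 hy).2

end LocalAlgebra

/-! ### Duality between logarithmic forms and logarithmic vector fields -/

/-- Divisibility may be tested after multiplying by each `∂ᵢ h`. Modulo `h`, the relation `dh ∧ a ≡
0` turns the contraction times `∂ᵢ h` into `δ(h) aᵢ`, which is divisible by `h`. -/
theorem dvd_sum_coord_mul {n : ℕ} {h : 𝒪 n} (hD : IsReducedEquation h) (δ : derLog h)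
    (a : logNum h) : h ∣ ∑ i, (δ : Θ n) (coord i) * (a : Fin n → 𝒪 n) i := by
  refine dvd_of_forall_dvd_mul_pd hD fun i => ?_
  have h1 : h ∣ (δ : Θ n) h := Ideal.mem_span_singleton.1 δ.2
  have h2 : (∑ j, (δ : Θ n) (coord j) * (a : Fin n → 𝒪 n) j) * pd i h =
      (δ : Θ n) h * (a : Fin n → 𝒪 n) i + ∑ j, (δ : Θ n) (coord j) *
        (pd i h * (a : Fin n → 𝒪 n) j - pd j h * (a : Fin n → 𝒪 n) i) := by
    rw [derivation_apply (δ : Θ n) h, Finset.sum_mul, Finset.sum_mul, ← Finset.sum_add_distrib]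
    refine Finset.sum_congr rfl fun j _ => ?_
    ring
  rw [h2]
  exact dvd_add (h1.mul_right _) (Finset.dvd_sum fun j _ => (a.2 i j).mul_left _)

/-- The contraction of logarithmic vector fields and logarithmic forms. -/
def pairing {n : ℕ} {h : 𝒪 n} (hD : IsReducedEquation h) :
    derLog h →ₗ[𝒪 n] logNum h →ₗ[𝒪 n] 𝒪 n :=
  LinearMap.mk₂ (𝒪 n) (fun δ a => (dvd_sum_coord_mul hD δ a).choose)
    (fun δ δ' a => mul_left_cancel₀ hD.ne_zero (by
      rw [mul_add, ← (dvd_sum_coord_mul hD _ a).choose_spec,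
        ← (dvd_sum_coord_mul hD δ a).choose_spec, ← (dvd_sum_coord_mul hD δ' a).choose_spec]
      simp [add_mul, Finset.sum_add_distrib]))
    (fun c δ a => mul_left_cancel₀ hD.ne_zero (by
      rw [smul_eq_mul, mul_left_comm, ← (dvd_sum_coord_mul hD _ a).choose_spec,
        ← (dvd_sum_coord_mul hD δ a).choose_spec]
      simp [Finset.mul_sum, mul_assoc]))
    (fun δ a b => mul_left_cancel₀ hD.ne_zero (by
      rw [mul_add, ← (dvd_sum_coord_mul hD δ _).choose_spec,
        ← (dvd_sum_coord_mul hD δ a).choose_spec, ← (dvd_sum_coord_mul hD δ b).choose_spec]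
      simp [mul_add, Finset.sum_add_distrib]))
    (fun c δ a => mul_left_cancel₀ hD.ne_zero (by
      rw [smul_eq_mul, mul_left_comm, ← (dvd_sum_coord_mul hD δ _).choose_spec,
        ← (dvd_sum_coord_mul hD δ a).choose_spec]
      simp [Finset.mul_sum, mul_left_comm]))

theorem mul_pairing {n : ℕ} {h : 𝒪 n} (hD : IsReducedEquation h) (δ : derLog h) (a : logNum h) :
    h * pairing hD δ a = ∑ i, (δ : Θ n) (coord i) * (a : Fin n → 𝒪 n) i :=
  (dvd_sum_coord_mul hD δ a).choose_spec.symm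

/-- `h` times a vector field, as a logarithmic vector field. -/
def mulField {n : ℕ} (h : 𝒪 n) : Θ n →ₗ[𝒪 n] derLog h where
  toFun D := ⟨h • D, Ideal.mem_span_singleton.2 ⟨D h, rfl⟩⟩
  map_add' _ _ := Subtype.ext (smul_add _ _ _)
  map_smul' _ _ := Subtype.ext (smul_comm _ _ _)

/-- A form is recovered from its pairings with the fields `h ∂ᵢ`, which are always logarithmic.
Freeness plays no role here. -/
theorem pairing_flip_bijective {n : ℕ} {h : 𝒪 n} (hD : IsReducedEquation h) :
    Function.Bijective (pairing hD).flip := by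
  constructor
  · rw [injective_iff_map_eq_zero]
    intro a ha
    ext i
    have h1 := mul_pairing hD (mulField h (pd i)) a
    have h2 : pairing hD (mulField h (pd i)) a = 0 := LinearMap.congr_fun ha _
    rw [h2, mul_zero] at h1
    have h3 : ∑ j, ((mulField h (pd i) : derLog h) : Θ n) (coord j) * (a : Fin n → 𝒪 n) j =
        h * (a : Fin n → 𝒪 n) i := by
      simp [mulField, pd_coord]
    rw [h3] at h1
    exact (mul_eq_zero.1 h1.symm).resolve_left hD.ne_zero
  · intro φ
    let a : Fin n → 𝒪 n := fun i => φ (mulField h (pd i))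
    have hφ : ∀ δ : derLog h, h * φ δ = ∑ i, (δ : Θ n) (coord i) * a i := by
      intro δ
      have : h • δ = ∑ i, (δ : Θ n) (coord i) • mulField h (pd i) := by
        apply Subtype.ext
        rw [Submodule.coe_smul, Submodule.coe_sum]
        ext f
        rw [Derivation.smul_apply, derivation_sum_apply, derivation_apply, smul_eq_mul,
          Finset.mul_sum]
        refine Finset.sum_congr rfl fun i _ => ?_
        simp [mulField, mul_left_comm]
      rw [← smul_eq_mul, ← map_smul, this, map_sum]
      simp only [map_smul, smul_eq_mul, a]
    have ha : a ∈ logNum h := by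
      intro i j
      -- This field annihilates `h`, and the value of `φ` on it is the quotient showing that `h`
      -- divides a coefficient of `dh ∧ a`.
      let D : derLog h := ⟨pd i h • pd j - pd j h • pd i, by
        change (pd i h • pd j - pd j h • pd i) h ∈ Ideal.span {h}
        simp [mul_comm]⟩
      refine ⟨φ D, ?_⟩
      rw [hφ]
      simp [D, pd_coord, sub_mul, Finset.sum_sub_distrib]
    refine ⟨⟨a, ha⟩, ?_⟩
    ext δ
    apply mul_left_cancel₀ hD.ne_zero
    rw [hφ, LinearMap.flip_apply, mul_pairing]

/-- The coefficients embed `derLog h` in a free module of rank `n`, and a free module of finite rank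
is finite. -/
theorem finite_derLog {n : ℕ} {h : 𝒪 n} (hfree : IsFreeDivisor h) :
    Module.Finite (𝒪 n) (derLog h) := by
  have : Module.Free (𝒪 n) (derLog h) := hfree
  let c : derLog h →ₗ[𝒪 n] (Fin n → 𝒪 n) :=
    { toFun := fun δ i => (δ : Θ n) (coord i)
      map_add' := fun _ _ => rfl
      map_smul' := fun _ _ => rfl }
  have hc : Function.Injective c := fun δ δ' e =>
    Subtype.ext (derivation_ext_coord fun i => congrFun e i)
  rw [← Module.rank_lt_aleph0_iff]
  refine (LinearMap.rank_le_of_injective c hc).trans_lt ?_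
  rw [Module.rank_lt_aleph0_iff]
  infer_instance

/-- For a free divisor, logarithmic forms are dual to logarithmic vector fields. -/
theorem free_finite_logNum {n : ℕ} {h : 𝒪 n} (hD : IsReducedEquation h)
    (hfree : IsFreeDivisor h) :
    Module.Free (𝒪 n) (logNum h) ∧ Module.Finite (𝒪 n) (logNum h) := by
  have h1 : Module.Free (𝒪 n) (derLog h) := hfree
  have h2 := finite_derLog hfree
  let e := LinearEquiv.ofBijective _ (pairing_flip_bijective hD)
  exact ⟨Module.Free.of_equiv e.symm, Module.Finite.equiv e.symm⟩

/-- Reflexivity of the finite free module `derLog h`; this is what makes basis membership visible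
through vector fields. -/
theorem exists_pairing_eq {n : ℕ} {h : 𝒪 n} (hD : IsReducedEquation h) (hfree : IsFreeDivisor h)
    (φ : logNum h →ₗ[𝒪 n] 𝒪 n) : ∃ δ, φ = pairing hD δ := by
  have h1 : Module.Free (𝒪 n) (derLog h) := hfree
  have h2 := finite_derLog hfree
  let e := LinearEquiv.ofBijective _ (pairing_flip_bijective hD)
  obtain ⟨δ, hδ⟩ := (Module.evalEquiv (𝒪 n) (derLog h)).surjective (φ ∘ₗ e.symm.toLinearMap)
  refine ⟨δ, LinearMap.ext fun a => ?_⟩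
  have := LinearMap.congr_fun hδ (e a)
  simp only [LinearMap.comp_apply, LinearEquiv.coe_coe, LinearEquiv.symm_apply_apply] at this
  rw [← this]
  rfl

theorem isPartOfBasis_divForm_iff {n : ℕ} {h : 𝒪 n} (hD : IsReducedEquation h)
    (hfree : IsFreeDivisor h) (a : logNum h) :
    IsPartOfBasis (logForms h) (divForm h a) ↔ ∃ δ, pairing hD δ a = 1 := by
  obtain ⟨h1, h2⟩ := free_finite_logNum hD hfree
  constructor
  · rintro ⟨ι, b, i, hb⟩
    obtain ⟨δ, hδ⟩ := exists_pairing_eq hD hfree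
      (b.coord i ∘ₗ (logEquiv hD.ne_zero).toLinearMap)
    refine ⟨δ, ?_⟩
    have hb' : logEquiv hD.ne_zero a = b i := Subtype.ext hb.symm
    rw [← hδ, LinearMap.comp_apply, LinearEquiv.coe_coe, hb']
    simp
  · rintro ⟨δ, hδ⟩
    obtain ⟨ι, b, i, hb⟩ := exists_basis_of_dual_eq_one _ hδ
    exact ⟨ι, b.map (logEquiv hD.ne_zero), i, by rw [Module.Basis.map_apply, hb, coe_logEquiv]⟩

theorem exists_pairing_eq_one_iff {n : ℕ} {h : 𝒪 n} (hD : IsReducedEquation h)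
    (hfree : IsFreeDivisor h) (a : logNum h) :
    (∃ δ, pairing hD δ a = 1) ↔ a ∉ maximalIdeal (𝒪 n) • (⊤ : Submodule (𝒪 n) (logNum h)) := by
  obtain ⟨h1, h2⟩ := free_finite_logNum hD hfree
  constructor
  · rintro ⟨δ, hδ⟩ ha
    have := dual_mem_maximalIdeal_of_mem ha (pairing hD δ)
    rw [hδ] at this
    exact (IsLocalRing.mem_maximalIdeal _).1 this isUnit_one
  · intro ha
    obtain ⟨φ, hφ⟩ := exists_dual_eq_one_of_notMem ha
    obtain ⟨δ, rfl⟩ := exists_pairing_eq hD hfree φ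
    exact ⟨δ, hφ⟩

/-! ### Contractions of `dh/h` and change of the equation -/

theorem pairing_dh {n : ℕ} {h : 𝒪 n} (hD : IsReducedEquation h) (δ : derLog h) :
    h * pairing hD δ (dh h) = (δ : Θ n) h := by
  rw [mul_pairing, derivation_apply (δ : Θ n) h]
  rfl

theorem pairing_holForm {n : ℕ} {h : 𝒪 n} (hD : IsReducedEquation h) (δ : derLog h)
    (η : Fin n → 𝒪 n) :
    pairing hD δ (holForm h η) = ∑ i, (δ : Θ n) (coord i) * η i := by
  apply mul_left_cancel₀ hD.ne_zero
  rw [mul_pairing, Finset.mul_sum]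
  exact Finset.sum_congr rfl fun i _ => by rw [coe_holForm]; ring

/-- The numerator over `h` of the logarithmic differential of `h * u`. -/
theorem dlog_mul_unit {n : ℕ} {h : 𝒪 n} (hh : h ≠ 0) (u : (𝒪 n)ˣ) :
    dlog (h * (u : 𝒪 n)) = divForm h (dh h + holForm h (fun i => ↑u⁻¹ * pd i (u : 𝒪 n)) : logNum h) := by
  have hh' := algebraMap_ne_zero hh
  have hu' := algebraMap_ne_zero u.ne_zero
  have hv : algebraMap (𝒪 n) (Mer n) u * algebraMap (𝒪 n) (Mer n) (↑u⁻¹ : 𝒪 n) = 1 := by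
    rw [← map_mul, Units.mul_inv, map_one]
  ext i
  simp only [dlog, divForm, Submodule.coe_add, Pi.add_apply, coe_dh, coe_holForm,
    Derivation.leibniz, smul_eq_mul, map_add, map_mul]
  rw [div_eq_div_iff (mul_ne_zero hh' hu') hh']
  linear_combination (-algebraMap (𝒪 n) (Mer n) h ^ 2 * algebraMap (𝒪 n) (Mer n) (pd i u)) * hv

theorem dlog_eq_divForm {n : ℕ} (h : 𝒪 n) : dlog h = divForm h (dh h : Fin n → 𝒪 n) := rfl

theorem exists_unit_of_span_eq {n : ℕ} {h h' : 𝒪 n} (e : Ideal.span {h'} = Ideal.span {h}) :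
    ∃ u : (𝒪 n)ˣ, h' = h * (u : 𝒪 n) := by
  obtain ⟨u, hu⟩ := Ideal.span_singleton_eq_span_singleton.1 e.symm
  exact ⟨u, hu.symm⟩

theorem span_mul_unit {n : ℕ} (h : 𝒪 n) (u : (𝒪 n)ˣ) :
    Ideal.span {h * (u : 𝒪 n)} = Ideal.span {h} :=
  Ideal.span_singleton_eq_span_singleton.2 ⟨u⁻¹, by simp [mul_assoc]⟩

theorem isPartOfBasis_dlog_iff {n : ℕ} {h : 𝒪 n} (hD : IsReducedEquation h)
    (hfree : IsFreeDivisor h) :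
    IsPartOfBasis (logForms h) (dlog h) ↔ IsEulerHomogeneous h := by
  rw [dlog_eq_divForm, isPartOfBasis_divForm_iff hD hfree]
  constructor
  · rintro ⟨δ, hδ⟩
    exact ⟨δ, δ.2, by rw [← pairing_dh hD, hδ, mul_one]⟩
  · rintro ⟨χ, hχ, e⟩
    refine ⟨⟨χ, hχ⟩, mul_left_cancel₀ hD.ne_zero ?_⟩
    rw [pairing_dh, e, mul_one]

/-! ### Residues -/

instance isLocalRing𝒪D {n : ℕ} (h : 𝒪 n) [Nontrivial (𝒪D h)] : IsLocalRing (𝒪D h) :=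
  IsLocalRing.of_surjective' (Ideal.Quotient.mk _) Ideal.Quotient.mk_surjective

theorem IsReducedEquation.nontrivial {n : ℕ} {h : 𝒪 n} (hD : IsReducedEquation h) :
    Nontrivial (𝒪D h) :=
  Ideal.Quotient.nontrivial_iff.2 fun e =>
    hD.not_dvd_one (Ideal.mem_span_singleton.1 (e ▸ Submodule.mem_top))

theorem mk_mem_maximalIdeal_iff {n : ℕ} {h : 𝒪 n} [Nontrivial (𝒪D h)] {c : 𝒪 n} :
    Ideal.Quotient.mk (Ideal.span {h}) c ∈ maximalIdeal (𝒪D h) ↔ c ∈ maximalIdeal (𝒪 n) := by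
  have : IsLocalHom (Ideal.Quotient.mk (Ideal.span {h})) :=
    .of_surjective _ Ideal.Quotient.mk_surjective
  rw [IsLocalRing.mem_maximalIdeal, IsLocalRing.mem_maximalIdeal, mem_nonunits_iff,
    mem_nonunits_iff, isUnit_map_iff]

/-- The residue map on numerators of logarithmic forms. -/
def residueMap {n : ℕ} {h : 𝒪 n} (hD : IsReducedEquation h) :
    logNum h →ₛₗ[Ideal.Quotient.mk (Ideal.span {h})] MerD h := (exists_residueMap hD).choose

theorem isResidue_iff_eq_residueMap {n : ℕ} {h : 𝒪 n} (hD : IsReducedEquation h) (a : logNum h)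
    (r : MerD h) : IsResidue h (divForm h a) r ↔ r = residueMap hD a :=
  (exists_residueMap hD).choose_spec.1 a r

theorem exists_eq_holForm {n : ℕ} {h : 𝒪 n} (hD : IsReducedEquation h) {a : logNum h}
    (ha : residueMap hD a = 0) : ∃ η, a = holForm h η :=
  (exists_residueMap hD).choose_spec.2 a ha

theorem mem_residues_iff {n : ℕ} {h : 𝒪 n} (hD : IsReducedEquation h) (r : MerD h) :
    r ∈ residues h ↔ ∃ a, residueMap hD a = r := by
  constructor
  · rintro ⟨ω, hω, hr⟩
    obtain ⟨a, ha, rfl⟩ := exists_eq_divForm hD.ne_zero hω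
    exact ⟨⟨a, ha⟩, ((isResidue_iff_eq_residueMap hD ⟨a, ha⟩ r).1 hr).symm⟩
  · rintro ⟨a, rfl⟩
    exact ⟨divForm h a, (divForm_mem_logForms_iff hD.ne_zero _).2 a.2,
      (isResidue_iff_eq_residueMap hD a _).2 rfl⟩

/-- If `a ≡ ξ dh` modulo `h`, then the residue of `a/h` is `ξ`. -/
theorem residueMap_eq_algebraMap {n : ℕ} {h : 𝒪 n} (hD : IsReducedEquation h) {a : logNum h}
    {ξ : 𝒪 n} (ha : ∀ i, h ∣ (a : Fin n → 𝒪 n) i - ξ * pd i h) :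
    residueMap hD a = algebraMap (𝒪D h) (MerD h) (Ideal.Quotient.mk (Ideal.span {h}) ξ) := by
  have h1 : Ideal.Quotient.mk (Ideal.span {h}) 1 ∈ (𝒪D h)⁰ := by
    rw [map_one]
    exact one_mem _
  symm
  rw [← isResidue_iff_eq_residueMap, isResidue_divForm_iff hD]
  refine ⟨1, ξ, h1, fun i => by rw [one_mul]; exact ha i, ?_⟩
  have : (⟨Ideal.Quotient.mk (Ideal.span {h}) 1, h1⟩ : (𝒪D h)⁰) = 1 := Subtype.ext (map_one _)
  rw [this, IsLocalization.mk'_one]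

theorem residueMap_dh_add_holForm {n : ℕ} {h : 𝒪 n} (hD : IsReducedEquation h)
    (η : Fin n → 𝒪 n) : residueMap hD (dh h + holForm h η) = 1 := by
  rw [residueMap_eq_algebraMap hD (ξ := 1), map_one, map_one]
  intro i
  rw [Submodule.coe_add, Pi.add_apply, coe_dh, coe_holForm]
  exact ⟨η i, by ring⟩

theorem one_mem_residues {n : ℕ} {h : 𝒪 n} (hD : IsReducedEquation h) : 1 ∈ residues h :=
  (mem_residues_iff hD _).2 ⟨_, residueMap_dh_add_holForm hD 0⟩

theorem residues_fg {n : ℕ} {h : 𝒪 n} (hD : IsReducedEquation h) (hfree : IsFreeDivisor h) :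
    (residues h).FG := by
  obtain ⟨h1, h2⟩ := free_finite_logNum hD hfree
  obtain ⟨s, hs⟩ := h2.fg_top
  classical
  refine ⟨s.image (residueMap hD), le_antisymm ?_ ?_⟩
  · rw [Submodule.span_le]
    intro r hr
    rw [Finset.coe_image] at hr
    obtain ⟨a, -, rfl⟩ := hr
    exact (mem_residues_iff hD _).2 ⟨a, rfl⟩
  · intro r hr
    obtain ⟨a, rfl⟩ := (mem_residues_iff hD _).1 hr
    have ha : a ∈ Submodule.span (𝒪 n) (s : Set (logNum h)) := hs ▸ Submodule.mem_top
    induction ha using Submodule.span_induction with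
    | mem x hx =>
      exact Submodule.subset_span (Finset.mem_coe.2 (Finset.mem_image_of_mem _ hx))
    | zero => rw [map_zero]; exact zero_mem _
    | add x y _ _ hx hy =>
      rw [map_add]
      exact add_mem (hx ((mem_residues_iff hD _).2 ⟨x, rfl⟩))
        (hy ((mem_residues_iff hD _).2 ⟨y, rfl⟩))
    | smul c x _ hx =>
      rw [map_smulₛₗ]
      exact Submodule.smul_mem _ _ (hx ((mem_residues_iff hD _).2 ⟨x, rfl⟩))

/-- The residue map is onto and semilinear over a surjection of local rings. Nakayama's criterion
for `1` can therefore be tested on forms. -/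
theorem mem_smul_residues_iff {n : ℕ} {h : 𝒪 n} (hD : IsReducedEquation h)
    [Nontrivial (𝒪D h)] (r : MerD h) :
    r ∈ maximalIdeal (𝒪D h) • residues h ↔
      ∃ a ∈ maximalIdeal (𝒪 n) • (⊤ : Submodule (𝒪 n) (logNum h)), residueMap hD a = r := by
  constructor
  · intro hr
    refine Submodule.smul_induction_on hr (fun c hc x hx => ?_) fun x y => ?_
    · obtain ⟨c, rfl⟩ := Ideal.Quotient.mk_surjective c
      obtain ⟨a, rfl⟩ := (mem_residues_iff hD _).1 hx
      exact ⟨c • a, Submodule.smul_mem_smul (mk_mem_maximalIdeal_iff.1 hc) Submodule.mem_top,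
        map_smulₛₗ _ _ _⟩
    · rintro ⟨a, ha, rfl⟩ ⟨b, hb, rfl⟩
      exact ⟨a + b, add_mem ha hb, map_add _ _ _⟩
  · rintro ⟨a, ha, rfl⟩
    refine Submodule.smul_induction_on ha (fun c hc x _ => ?_) fun x y hx hy => ?_
    · rw [map_smulₛₗ]
      exact Submodule.smul_mem_smul (mk_mem_maximalIdeal_iff.2 hc)
        ((mem_residues_iff hD _).2 ⟨x, rfl⟩)
    · rw [map_add]
      exact add_mem hx hy

theorem holForm_mem_of_mem_maximalIdeal {n : ℕ} (h : 𝒪 n) {η : Fin n → 𝒪 n}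
    (hη : ∀ i, η i ∈ maximalIdeal (𝒪 n)) :
    holForm h η ∈ maximalIdeal (𝒪 n) • (⊤ : Submodule (𝒪 n) (logNum h)) := by
  classical
  have : holForm h η = ∑ i, η i • holForm h (Pi.single i 1) := by
    simp only [← map_smul]
    rw [← map_sum]
    congr 1
    ext1 j
    simp [Finset.sum_apply, Pi.single_apply]
  rw [this]
  exact Submodule.sum_mem _ fun i _ => Submodule.smul_mem_smul (hη i) Submodule.mem_top

theorem isPartOfBasis_dlog_mul_unit_iff {n : ℕ} {h : 𝒪 n} (hD : IsReducedEquation h)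
    (hfree : IsFreeDivisor h) (u : (𝒪 n)ˣ) :
    IsPartOfBasis (logForms h) (dlog (h * (u : 𝒪 n))) ↔
      dh h + holForm h (fun i => ↑u⁻¹ * pd i (u : 𝒪 n)) ∉
        maximalIdeal (𝒪 n) • (⊤ : Submodule (𝒪 n) (logNum h)) := by
  rw [dlog_mul_unit hD.ne_zero, isPartOfBasis_divForm_iff hD hfree,
    exists_pairing_eq_one_iff hD hfree]

theorem isPartOfMinimalGenerators_one_iff {n : ℕ} {h : 𝒪 n} (hD : IsReducedEquation h)
    (hfree : IsFreeDivisor h) :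
    IsPartOfMinimalGenerators (residues h) 1 ↔
      ∀ h' : 𝒪 n, Ideal.span {h'} = Ideal.span {h} →
        IsPartOfBasis (logForms h) (dlog h') := by
  have := hD.nontrivial
  rw [isPartOfMinimalGenerators_iff (residues_fg hD hfree) (one_mem_residues hD),
    mem_smul_residues_iff hD]
  constructor
  · intro H h' hh'
    obtain ⟨u, rfl⟩ := exists_unit_of_span_eq hh'
    rw [isPartOfBasis_dlog_mul_unit_iff hD hfree]
    exact fun ha => H ⟨_, ha, residueMap_dh_add_holForm hD _⟩
  · rintro H ⟨a, ha, ha1⟩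
    have h0 : residueMap hD (a - dh h) = 0 := by
      have := residueMap_dh_add_holForm hD 0
      rw [map_zero, add_zero] at this
      rw [map_sub, ha1, this, sub_self]
    obtain ⟨η, hη⟩ := exists_eq_holForm hD h0
    -- An affine unit with `dw/w` equal to `η` at `0`. For the equation `h w`, the numerator then
    -- differs from `a` by `h` times a form with coefficients in `𝔪`.
    let w : 𝒪 n := 1 + ∑ i, algebraMap ℂ (𝒪 n) (value₀ (η i)) * coord i
    have hw0 : value₀ w = 1 := by
      rw [← valueHom_apply]
      simp only [w, map_add, map_one, map_sum, map_mul, AlgHom.commutes]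
      simp [valueHom_apply, value₀_coord]
    have hw : IsUnit w := (isUnit_iff_value_ne_zero w).2 (by rw [hw0]; exact one_ne_zero)
    obtain ⟨u, hu⟩ := hw
    have hpd : ∀ i, pd i (u : 𝒪 n) = algebraMap ℂ (𝒪 n) (value₀ (η i)) := by
      intro i
      rw [hu]
      simp [w, pd_coord]
    have hui : value₀ (↑u⁻¹ : 𝒪 n) = 1 := by
      have := congrArg (valueHom n) (Units.mul_inv u)
      rwa [map_mul, map_one, hu, valueHom_apply, hw0, one_mul] at this
    refine (isPartOfBasis_dlog_mul_unit_iff hD hfree u).1 (H _ (span_mul_unit h u)) ?_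
    have e : dh h + holForm h (fun i => ↑u⁻¹ * pd i (u : 𝒪 n)) =
        a + holForm h (fun i => ↑u⁻¹ * pd i (u : 𝒪 n) - η i) := by
      have : (fun i => ↑u⁻¹ * pd i (u : 𝒪 n) - η i) =
        (fun i => ↑u⁻¹ * pd i (u : 𝒪 n)) - η := rfl
      rw [this, map_sub, ← hη]
      abel
    rw [e]
    refine add_mem ha (holForm_mem_of_mem_maximalIdeal h fun i => ?_)
    rw [mem_maximalIdeal_iff, hpd, ← valueHom_apply, map_sub, map_mul, AlgHom.commutes,
      valueHom_apply, valueHom_apply, hui]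
    simp

theorem isPartOfBasis_dlog_iff_isPartOfMinimalGenerators {n : ℕ} {h : 𝒪 n}
    (hD : IsReducedEquation h) (hfree : IsFreeDivisor h) (had : IsAdaptedEquation h) :
    IsPartOfBasis (logForms h) (dlog h) ↔ IsPartOfMinimalGenerators (residues h) 1 := by
  rw [isPartOfMinimalGenerators_one_iff hD hfree]
  refine ⟨fun H h' hh' => ?_, fun H => H h rfl⟩
  obtain ⟨χ, hχ, e⟩ := (isPartOfBasis_dlog_iff hD hfree).1 H
  obtain ⟨δ, hδ, hv⟩ := had χ hχ
  obtain ⟨u, rfl⟩ := exists_unit_of_span_eq hh'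
  rw [isPartOfBasis_dlog_mul_unit_iff hD hfree]
  intro hm
  -- Still an Euler field for `h`, but vanishing at `0`: its contraction with every holomorphic form
  -- lies in `𝔪`, so it pairs to a unit with the numerator belonging to any other equation.
  let D : derLog h := ⟨χ - δ, by
    change (χ - δ) h ∈ Ideal.span {h}
    rw [Derivation.sub_apply, e, hδ, sub_zero]
    exact Ideal.mem_span_singleton_self h⟩
  have h1 := dual_mem_maximalIdeal_of_mem hm (pairing hD D)
  have h2 : pairing hD D (dh h) = 1 := by
    apply mul_left_cancel₀ hD.ne_zero
    rw [pairing_dh, mul_one]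
    change (χ - δ) h = h
    rw [Derivation.sub_apply, e, hδ, sub_zero]
  rw [map_add, h2, pairing_holForm, mem_maximalIdeal_iff, ← valueHom_apply, map_add, map_one,
    map_sum] at h1
  have h3 : ∀ i, valueHom n ((D : Θ n) (coord i)) = 0 := by
    intro i
    change valueHom n ((χ - δ) (coord i)) = 0
    rw [Derivation.sub_apply, map_sub, valueHom_apply, valueHom_apply, hv, sub_self]
  simp [h3] at h1

/-! ### Values of logarithmic vector fields at the origin -/

/-- The values at `0` of the logarithmic vector fields. -/
def logTangent {n : ℕ} (h : 𝒪 n) : Submodule ℂ (Fin n → ℂ) where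
  carrier := {v | ∃ δ ∈ derLog h, ∀ i, value₀ (δ (coord i)) = v i}
  add_mem' := by
    rintro v w ⟨δ, hδ, hv⟩ ⟨δ', hδ', hw⟩
    refine ⟨δ + δ', add_mem hδ hδ', fun i => ?_⟩
    rw [Derivation.add_apply, ← valueHom_apply, map_add, valueHom_apply, valueHom_apply, hv, hw]
    rfl
  zero_mem' := ⟨0, zero_mem _, fun i => (valueHom n).map_zero⟩
  smul_mem' := by
    rintro c v ⟨δ, hδ, hv⟩
    refine ⟨algebraMap ℂ (𝒪 n) c • δ, Submodule.smul_mem _ _ hδ, fun i => ?_⟩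
    rw [Derivation.smul_apply, smul_eq_mul, ← valueHom_apply, map_mul, AlgHom.commutes,
      valueHom_apply, hv]
    rfl

/-- Nakayama's lemma for vector fields. -/
theorem eq_top_of_forall_exists_value₀_eq {n : ℕ} {W : Submodule (𝒪 n) (Θ n)}
    (hW : ∀ D : Θ n, ∃ δ ∈ W, ∀ i, value₀ (δ (coord i)) = value₀ (D (coord i))) : W = ⊤ := by
  classical
  have hspan : ∀ D : Θ n, D = ∑ i, D (coord i) • pd i := fun D =>
    derivation_ext_coord fun j => by
      rw [derivation_sum_apply]
      simp [pd_coord]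
  have hfg : (⊤ : Submodule (𝒪 n) (Θ n)).FG := by
    refine ⟨Finset.univ.image pd, eq_top_iff.2 fun D _ => ?_⟩
    rw [hspan D]
    exact Submodule.sum_mem _ fun i _ => Submodule.smul_mem _ _
      (Submodule.subset_span (Finset.mem_coe.2 (Finset.mem_image_of_mem _ (Finset.mem_univ i))))
  rw [eq_top_iff]
  refine Submodule.le_of_le_smul_of_le_jacobson_bot hfg
    (IsLocalRing.maximalIdeal_le_jacobson _) fun D _ => ?_
  obtain ⟨δ, hδ, hv⟩ := hW D
  rw [← add_sub_cancel δ D]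
  refine Submodule.add_mem_sup hδ ?_
  rw [hspan (D - δ)]
  refine Submodule.sum_mem _ fun i _ => Submodule.smul_mem_smul ?_ Submodule.mem_top
  rw [mem_maximalIdeal_iff, Derivation.sub_apply, ← valueHom_apply, map_sub, valueHom_apply,
    valueHom_apply, hv, sub_self]

/-- Otherwise all vector fields are logarithmic by Nakayama, so `h` divides all its partial
derivatives, which is impossible for a reduced equation. -/
theorem logTangent_ne_top {n : ℕ} {h : 𝒪 n} (hD : IsReducedEquation h) : logTangent h ≠ ⊤ := by
  intro e
  have : derLog h = ⊤ := by
    refine eq_top_of_forall_exists_value₀_eq fun D => ?_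
    have : (fun i => value₀ (D (coord i))) ∈ logTangent h := e ▸ Submodule.mem_top
    exact this
  refine hD.not_dvd_one (dvd_of_forall_dvd_mul_pd hD fun i => ?_)
  have h1 : pd i ∈ derLog h := this ▸ Submodule.mem_top
  rw [one_mul]
  exact Ideal.mem_span_singleton.1 h1

theorem exists_functional_logTangent {n : ℕ} {h : 𝒪 n} (hD : IsReducedEquation h) :
    ∃ f : (Fin n → ℂ) →ₗ[ℂ] ℂ, f ≠ 0 ∧ ∀ v ∈ logTangent h, f v = 0 := by
  obtain ⟨f, hf, hle⟩ := Submodule.exists_le_ker_of_lt_top _ (lt_top_iff_ne_top.2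
    (logTangent_ne_top hD))
  exact ⟨f, hf, fun v hv => hle hv⟩

theorem functional_apply {n : ℕ} (f : (Fin n → ℂ) →ₗ[ℂ] ℂ) (v : Fin n → ℂ) :
    f v = ∑ i, v i * f (Pi.single i 1) := by
  conv_lhs => rw [pi_eq_sum_univ' v, map_sum]
  exact Finset.sum_congr rfl fun i _ => by rw [map_smul, smul_eq_mul]

/-! ### Divisors with cyclic residues -/

/-- By duality, a form outside `𝔪 • logNum h` pairs to `1` with some logarithmic field; for a
constant holomorphic form that pairing has value `f(δ(0))` at the origin. -/
theorem mem_smul_top_of_forall_logTangent {n : ℕ} {h : 𝒪 n} (hD : IsReducedEquation h)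
    (hfree : IsFreeDivisor h) {f : (Fin n → ℂ) →ₗ[ℂ] ℂ} (hf : ∀ v ∈ logTangent h, f v = 0) :
    holForm h (fun i => algebraMap ℂ (𝒪 n) (f (Pi.single i 1))) ∈
      maximalIdeal (𝒪 n) • (⊤ : Submodule (𝒪 n) (logNum h)) := by
  by_contra H
  obtain ⟨δ, hδ⟩ := (exists_pairing_eq_one_iff hD hfree _).2 H
  rw [pairing_holForm] at hδ
  have h1 := hf (fun i => value₀ ((δ : Θ n) (coord i))) ⟨δ, δ.2, fun i => rfl⟩
  rw [functional_apply] at h1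
  have h2 := congrArg (valueHom n) hδ
  simp only [map_sum, map_mul, AlgHom.commutes, map_one] at h2
  exact one_ne_zero (h2.symm.trans h1)

theorem holForm_injective {n : ℕ} {h : 𝒪 n} (hh : h ≠ 0) : Function.Injective (holForm h) := by
  intro η θ e
  ext1 i
  exact mul_left_cancel₀ hh (congrFun (congrArg Subtype.val e) i)

/-- If the residues are cyclic, then the logarithmic vector fields span a space of codimension at
most one at the origin. -/
theorem functional_minor_eq_zero {n : ℕ} {h : 𝒪 n} (hD : IsReducedEquation h)
    (hfree : IsFreeDivisor h) (hcyc : (residues h).IsPrincipal)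
    {f g : (Fin n → ℂ) →ₗ[ℂ] ℂ} (hf : ∀ v ∈ logTangent h, f v = 0)
    (hg : ∀ v ∈ logTangent h, g v = 0) (i j : Fin n) :
    f (Pi.single i 1) * g (Pi.single j 1) = f (Pi.single j 1) * g (Pi.single i 1) := by
  obtain ⟨r, hr⟩ := hcyc
  obtain ⟨a₀, ha₀⟩ := (mem_residues_iff hD r).1 (hr ▸ Submodule.mem_span_singleton_self r)
  have htop : ∀ b, ∃ (c : 𝒪 n) (η : Fin n → 𝒪 n), b = c • a₀ + holForm h η := by
    intro b
    have hb : residueMap hD b ∈ residues h := (mem_residues_iff hD _).2 ⟨b, rfl⟩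
    rw [hr] at hb
    obtain ⟨c, hc⟩ := Submodule.mem_span_singleton.1 hb
    obtain ⟨c, rfl⟩ := Ideal.Quotient.mk_surjective c
    obtain ⟨η, hη⟩ := exists_eq_holForm hD (a := b - c • a₀) (by
      rw [map_sub, map_smulₛₗ, ha₀, hc, sub_self])
    exact ⟨c, η, by rw [← hη]; abel⟩
  have hmtop : ∀ a ∈ maximalIdeal (𝒪 n) • (⊤ : Submodule (𝒪 n) (logNum h)),
      ∃ (c : 𝒪 n) (η : Fin n → 𝒪 n), (∀ i, η i ∈ maximalIdeal (𝒪 n)) ∧ a = c • a₀ + holForm h η := by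
    intro a ha
    refine Submodule.smul_induction_on ha (fun x hx b _ => ?_) fun x y => ?_
    · obtain ⟨c, η, rfl⟩ := htop b
      exact ⟨x * c, x • η, fun i => Ideal.mul_mem_right _ _ hx, by
        rw [smul_add, map_smul, smul_smul]⟩
    · rintro ⟨c, η, hη, rfl⟩ ⟨d, θ, hθ, rfl⟩
      exact ⟨c + d, η + θ, fun i => add_mem (hη i) (hθ i), by rw [add_smul, map_add]; abel⟩
  -- Every functional vanishing on `logTangent h` is the value at `0` of a form `v` with `h v` a
  -- multiple of the single form `a₀`. Two such forms are proportional, so their `2 × 2` minors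
  -- vanish, also at `0`.
  have hlift : ∀ f : (Fin n → ℂ) →ₗ[ℂ] ℂ, (∀ v ∈ logTangent h, f v = 0) →
      ∃ (c : 𝒪 n) (v : Fin n → 𝒪 n), (∀ i, value₀ (v i) = f (Pi.single i 1)) ∧ holForm h v = c • a₀ := by
    intro f hf
    obtain ⟨c, η, hη, e⟩ := hmtop _ (mem_smul_top_of_forall_logTangent hD hfree hf)
    refine ⟨c, (fun i => algebraMap ℂ (𝒪 n) (f (Pi.single i 1))) - η, fun i => ?_, ?_⟩
    · rw [Pi.sub_apply, ← valueHom_apply, map_sub, AlgHom.commutes, valueHom_apply,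
        (mem_maximalIdeal_iff _).1 (hη i), sub_zero]
      rfl
    · rw [map_sub, e, add_sub_cancel_right]
  obtain ⟨c, v, hv, ev⟩ := hlift f hf
  obtain ⟨d, w, hw, ew⟩ := hlift g hg
  have hdc : ∀ i, d * v i = c * w i := by
    have : holForm h (d • v) = holForm h (c • w) := by
      rw [map_smul, map_smul, ev, ew, smul_smul, smul_smul, mul_comm]
    exact fun i => congrFun (holForm_injective hD.ne_zero this) i
  by_contra hne
  have hu : v i * w j - v j * w i ≠ 0 := by
    intro h0
    have := congrArg (valueHom n) h0
    simp only [map_sub, map_mul, valueHom_apply, hv, hw, map_zero] at this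
    exact hne (sub_eq_zero.1 this)
  have hc0 : c = 0 := by
    refine (mul_eq_zero.1 (?_ : c * (v i * w j - v j * w i) = 0)).resolve_right hu
    linear_combination v j * hdc i - v i * hdc j
  have hvz : v = 0 := by
    apply holForm_injective hD.ne_zero
    rw [ev, hc0, zero_smul, map_zero]
  apply hu
  simp [hvz]

theorem exists_derLog_sup_span_pd_eq_top {n : ℕ} {h : 𝒪 n} (hD : IsReducedEquation h)
    (hfree : IsFreeDivisor h) (hcyc : (residues h).IsPrincipal) :
    ∃ p : Fin n, derLog h ⊔ Submodule.span (𝒪 n) {pd p} = ⊤ := by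
  obtain ⟨f, hf0, hf⟩ := exists_functional_logTangent hD
  have hp : ∃ p, f (Pi.single p 1) ≠ 0 := by
    by_contra! H
    apply hf0
    refine LinearMap.ext fun v => ?_
    rw [functional_apply]
    simp [H]
  obtain ⟨p, hp⟩ := hp
  -- A functional separating `x` from `logTangent h` would be a multiple of `f`, by the vanishing
  -- minors.
  have hker : ∀ x, f x = 0 → x ∈ logTangent h := by
    intro x hx
    by_contra hxn
    obtain ⟨g, hgx, hg⟩ := Submodule.exists_le_ker_of_notMem hxn
    apply hgx
    have h1 : f (Pi.single p 1) * g x = g (Pi.single p 1) * f x := by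
      rw [functional_apply f x, functional_apply g x, Finset.mul_sum, Finset.mul_sum]
      refine Finset.sum_congr rfl fun i _ => ?_
      have := functional_minor_eq_zero hD hfree hcyc hf (fun v hv => hg hv) p i
      linear_combination x i * this
    rw [hx, mul_zero] at h1
    exact (mul_eq_zero.1 h1).resolve_left hp
  refine ⟨p, eq_top_of_forall_exists_value₀_eq fun D => ?_⟩
  let v : Fin n → ℂ := fun i => value₀ (D (coord i))
  let t : ℂ := f v / f (Pi.single p 1)
  have hmem : v - t • Pi.single p (1 : ℂ) ∈ logTangent h := by
    apply hker
    rw [map_sub, map_smul, smul_eq_mul, div_mul_cancel₀ _ hp, sub_self]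
  obtain ⟨δ, hδ, hδv⟩ := hmem
  refine ⟨δ + algebraMap ℂ (𝒪 n) t • pd p, Submodule.add_mem_sup hδ
    (Submodule.smul_mem _ _ (Submodule.mem_span_singleton_self _)), fun i => ?_⟩
  rw [Derivation.add_apply, Derivation.smul_apply, pd_coord, ← valueHom_apply, map_add,
    valueHom_apply, hδv, smul_eq_mul, map_mul, AlgHom.commutes]
  simp only [Pi.sub_apply, Pi.smul_apply, Pi.single_apply, smul_eq_mul, v]
  by_cases hip : i = p
  · subst hip
    simp
  · simp [hip, Ne.symm hip]

/-! ### Derivatives of the equation along a transversal coordinate -/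

theorem derivation_mem_of_mem_span {R A : Type*} [CommRing R] [CommRing A] [Algebra R A]
    (D : Derivation R A A) {S : Set A} {J : Ideal A} (hS : ∀ x ∈ S, x ∈ J)
    (hDS : ∀ x ∈ S, D x ∈ J) {x : A} (hx : x ∈ Ideal.span S) : D x ∈ J := by
  have hSJ : Ideal.span S ≤ J := Ideal.span_le.2 hS
  induction hx using Submodule.span_induction with
  | mem x hx => exact hDS x hx
  | zero => rw [map_zero]; exact zero_mem _
  | add x y _ _ hx hy => rw [map_add]; exact add_mem hx hy
  | smul c x hx' hx =>
    rw [smul_eq_mul, Derivation.leibniz, smul_eq_mul, smul_eq_mul]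
    exact add_mem (J.mul_mem_left _ hx) (J.mul_mem_right _ (hSJ hx'))

/-- The ideal generated by `h` and its first `k` derivatives along `xₚ`. -/
def jetIdeal {n : ℕ} (p : Fin n) (h : 𝒪 n) (k : ℕ) : Ideal (𝒪 n) :=
  Ideal.span ((fun j => (pd p)^[j] h) '' Set.Iic k)

theorem iterate_pd_mem_jetIdeal {n : ℕ} (p : Fin n) (h : 𝒪 n) {j k : ℕ} (hjk : j ≤ k) :
    (pd p)^[j] h ∈ jetIdeal p h k :=
  Ideal.subset_span ⟨j, hjk, rfl⟩

theorem jetIdeal_mono {n : ℕ} (p : Fin n) (h : 𝒪 n) {j k : ℕ} (hjk : j ≤ k) :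
    jetIdeal p h j ≤ jetIdeal p h k :=
  Ideal.span_mono (Set.image_mono (Set.Iic_subset_Iic.2 hjk))

theorem pd_mem_jetIdeal_succ {n : ℕ} (p : Fin n) (h : 𝒪 n) (k : ℕ) {x : 𝒪 n}
    (hx : x ∈ jetIdeal p h k) : pd p x ∈ jetIdeal p h (k + 1) := by
  refine derivation_mem_of_mem_span (pd p) ?_ ?_ hx
  · rintro _ ⟨j, hj, rfl⟩
    exact iterate_pd_mem_jetIdeal p h (Nat.le_succ_of_le hj)
  · rintro _ ⟨j, hj, rfl⟩
    rw [← Function.iterate_succ_apply' (pd p) j h]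
    exact iterate_pd_mem_jetIdeal p h (Nat.succ_le_succ hj)

section Jets

variable {n : ℕ} {h : 𝒪 n} {p : Fin n}

theorem exists_add_smul_pd (hp : derLog h ⊔ Submodule.span (𝒪 n) {pd p} = ⊤) (D : Θ n) :
    ∃ δ ∈ derLog h, ∃ c : 𝒪 n, D = δ + c • pd p := by
  have : D ∈ derLog h ⊔ Submodule.span (𝒪 n) {pd p} := hp ▸ Submodule.mem_top
  obtain ⟨δ, hδ, x, hx, rfl⟩ := Submodule.mem_sup.1 this
  obtain ⟨c, rfl⟩ := Submodule.mem_span_singleton.1 hx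
  exact ⟨δ, hδ, c, rfl⟩

/-- Commuting `δ` past one `∂ₚ` costs `⁅δ, ∂ₚ⁆ = δ' + c ∂ₚ` with `δ'` again logarithmic. The
induction must hence treat all of `derLog h` at once. -/
theorem derLog_iterate_mem_jetIdeal (hp : derLog h ⊔ Submodule.span (𝒪 n) {pd p} = ⊤) (k : ℕ) :
    ∀ δ ∈ derLog h, δ ((pd p)^[k] h) ∈ jetIdeal p h k := by
  induction k with
  | zero =>
    intro δ hδ
    refine Ideal.span_mono ?_ (show δ h ∈ Ideal.span {h} from hδ)
    rintro _ rfl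
    exact ⟨0, by simp, rfl⟩
  | succ k ih =>
    intro δ hδ
    obtain ⟨δ', hδ', c, e⟩ := exists_add_smul_pd hp ⁅δ, pd p⁆
    have h1 : δ ((pd p)^[k + 1] h) = pd p (δ ((pd p)^[k] h)) +
        (δ' ((pd p)^[k] h) + c * (pd p)^[k + 1] h) := by
      have := congrArg (fun D : Θ n => D ((pd p)^[k] h)) e
      simp only [Derivation.commutator_apply, Derivation.add_apply, Derivation.smul_apply,
        smul_eq_mul] at this
      rw [Function.iterate_succ_apply', ← this]
      ring
    rw [h1]
    exact add_mem (pd_mem_jetIdeal_succ p h k (ih δ hδ))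
      (add_mem (jetIdeal_mono p h (Nat.le_succ k) (ih δ' hδ'))
        (Ideal.mul_mem_left _ _ (iterate_pd_mem_jetIdeal p h le_rfl)))

theorem derLog_mem_jetIdeal (hp : derLog h ⊔ Submodule.span (𝒪 n) {pd p} = ⊤) (k : ℕ)
    {δ : Θ n} (hδ : δ ∈ derLog h) {x : 𝒪 n} (hx : x ∈ jetIdeal p h k) :
    δ x ∈ jetIdeal p h k := by
  refine derivation_mem_of_mem_span δ ?_ ?_ hx
  · exact fun x hx => Ideal.subset_span hx
  · rintro _ ⟨j, hj, rfl⟩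
    exact jetIdeal_mono p h hj (derLog_iterate_mem_jetIdeal hp j δ hδ)

/-- The ideal of all iterated derivatives of `h` along `∂ₚ` is stable under `derLog h` and `∂ₚ`, so
under all vector fields. Being nonzero, it cannot be proper. -/
theorem exists_iterate_pd_notMem (hp : derLog h ⊔ Submodule.span (𝒪 n) {pd p} = ⊤)
    (hh : h ≠ 0) : ∃ d, (pd p)^[d] h ∉ maximalIdeal (𝒪 n) := by
  by_contra! H
  have hle : ∀ k, jetIdeal p h k ≤ maximalIdeal (𝒪 n) := by
    intro k
    refine Ideal.span_le.2 ?_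
    rintro _ ⟨j, -, rfl⟩
    exact H j
  let I : Ideal (𝒪 n) := Ideal.span (Set.range fun j => (pd p)^[j] h)
  have hkI : ∀ k, jetIdeal p h k ≤ I := fun k => Ideal.span_mono (Set.image_subset_range _ _)
  have hI : I = ⊥ := by
    apply eq_bot_of_derivation_stable
    · intro e
      refine (maximalIdeal.isMaximal (𝒪 n)).ne_top (top_le_iff.1 (e ▸ Ideal.span_le.2 ?_))
      rintro _ ⟨j, rfl⟩
      exact H j
    · intro D f hf
      refine derivation_mem_of_mem_span D (fun x hx => Ideal.subset_span hx) ?_ hf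
      rintro _ ⟨j, rfl⟩
      obtain ⟨δ, hδ, c, rfl⟩ := exists_add_smul_pd hp D
      rw [Derivation.add_apply, Derivation.smul_apply]
      refine add_mem (hkI j (derLog_iterate_mem_jetIdeal hp j δ hδ)) (Ideal.mul_mem_left _ _ ?_)
      rw [← Function.iterate_succ_apply' (pd p) j h]
      exact Ideal.subset_span ⟨j + 1, rfl⟩
  have : h ∈ I := Ideal.subset_span ⟨0, rfl⟩
  rw [hI] at this
  exact hh this

end Jets

/-- The prime ideal of a smooth hypersurface contains no smaller nonzero prime ideal. -/
theorem span_mem_minimalPrimes {n : ℕ} {f h : 𝒪 n} (hf : (Ideal.span {f}).IsPrime)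
    (hfm : f ∈ maximalIdeal (𝒪 n)) (hh : h ≠ 0) (hfh : h ∈ Ideal.span {f}) :
    Ideal.span {f} ∈ (Ideal.span {h}).minimalPrimes := by
  refine ⟨⟨hf, (Ideal.span_singleton_le_iff_mem _).2 hfh⟩, ?_⟩
  rintro Q ⟨hQ, hhQ⟩ hQf
  -- With `h = f ^ j y` for the largest `j`, the factor `y` is outside `(f)`, so a prime `Q ≤ (f)`
  -- containing `h` must contain `f`.
  have hex : ∃ j, ¬ f ^ j ∣ h := by
    by_contra! H
    exact hh (eq_zero_of_forall_mem_pow fun j => Ideal.mem_of_dvd _ (H j) (Ideal.pow_mem_pow hfm j))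
  classical
  obtain ⟨j, hj⟩ : ∃ j, Nat.find hex = j + 1 := Nat.exists_eq_succ_of_ne_zero fun h0 => by
    have := Nat.find_spec hex
    rw [h0, pow_zero] at this
    exact this (one_dvd _)
  obtain ⟨y, rfl⟩ : f ^ j ∣ h := not_not.1 (Nat.find_min hex (by omega))
  have hy : y ∉ Ideal.span {f} := by
    intro hy
    obtain ⟨z, rfl⟩ := Ideal.mem_span_singleton.1 hy
    have := Nat.find_spec hex
    rw [hj] at this
    exact this ⟨z, by ring⟩
  rw [Ideal.span_singleton_le_iff_mem]
  have hmem : f ^ j * y ∈ Q := hhQ (Ideal.mem_span_singleton_self _)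
  exact hQ.mem_of_pow_mem j ((hQ.mem_or_mem hmem).resolve_right fun h => hy (hQf h))

theorem exists_value₀_pd_ne_zero_of_isPrincipal {n : ℕ} {h : 𝒪 n} (hD : IsReducedEquation h)
    (hfree : IsFreeDivisor h) (hcyc : (residues h).IsPrincipal) :
    ∃ p : Fin n, value₀ (pd p h) ≠ 0 := by
  classical
  obtain ⟨p, hp⟩ := exists_derLog_sup_span_pd_eq_top hD hfree hcyc
  have hex := exists_iterate_pd_notMem hp hD.ne_zero
  obtain ⟨k, hk⟩ : ∃ k, Nat.find hex = k + 1 := Nat.exists_eq_succ_of_ne_zero fun h0 => by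
    have := Nat.find_spec hex
    rw [h0] at this
    exact this hD.mem_maximalIdeal
  have hlow : ∀ j ≤ k, (pd p)^[j] h ∈ maximalIdeal (𝒪 n) := fun j hj =>
    not_not.1 (Nat.find_min hex (by omega))
  have htop : value₀ (pd p ((pd p)^[k] h)) ≠ 0 := by
    have := Nat.find_spec hex
    rwa [hk, Function.iterate_succ_apply', mem_maximalIdeal_iff] at this
  rcases Nat.eq_zero_or_pos k with rfl | hkpos
  · exact ⟨p, htop⟩
  exfalso
  set f := (pd p)^[k] h with hfdef
  have hfm : f ∈ maximalIdeal (𝒪 n) := hlow k le_rfl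
  obtain ⟨m, rfl⟩ : ∃ m, n = m + 1 := Nat.exists_eq_succ_of_ne_zero fun h0 => by
    subst h0
    exact p.elim0
  obtain ⟨π, hπ, hker⟩ := exists_surjective_ker_eq_span p ((mem_maximalIdeal_iff f).1 hfm) htop
  have hIm : jetIdeal p h k ≤ maximalIdeal (𝒪 (m + 1)) := by
    refine Ideal.span_le.2 ?_
    rintro _ ⟨j, hj, rfl⟩
    exact hlow j hj
  have hfI : Ideal.span {f} ≤ jetIdeal p h k :=
    (Ideal.span_singleton_le_iff_mem _).2 (iterate_pd_mem_jetIdeal p h le_rfl)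
  -- A derivation of the hypersurface `f = 0` lifts to a field `δ + e ∂ₚ` sending `f` into `(f)`. As
  -- `δ` preserves the jet ideal and `∂ₚ f` is a unit, `e` lies in the jet ideal, so the lift
  -- preserves it too.
  have hmap : (jetIdeal p h k).map π = ⊥ := by
    apply eq_bot_of_derivation_stable
    · intro e
      have h1 : (1 : 𝒪 m) ∈ (jetIdeal p h k).map π := e ▸ Submodule.mem_top
      obtain ⟨x, hx, hx1⟩ := (Ideal.mem_map_iff_of_surjective π hπ).1 h1
      have := (algHom_mem_maximalIdeal π).2 (hIm hx)
      rw [hx1] at this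
      exact (IsLocalRing.mem_maximalIdeal _).1 this isUnit_one
    · intro D y hy
      obtain ⟨g, hg, rfl⟩ := (Ideal.mem_map_iff_of_surjective π hπ).1 hy
      choose c hc using fun i => hπ (D (π (coord i)))
      have hlift : ∀ x, D (π x) = π (vecField c x) := by
        intro x
        rw [derivation_algHom_apply, vecField_apply, map_sum]
        exact Finset.sum_congr rfl fun i _ => by rw [map_mul, hc]
      obtain ⟨δ, hδ, e, he⟩ := exists_add_smul_pd hp (vecField c)
      have hx : ∀ x, vecField c x = δ x + e * pd p x := fun x => by
        rw [he, Derivation.add_apply, Derivation.smul_apply, smul_eq_mul]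
      have h1 : vecField c f ∈ jetIdeal p h k := by
        apply hfI
        rw [← hker, ← hlift, (hker f).2 (Ideal.mem_span_singleton_self f), map_zero]
      have h2 : e ∈ jetIdeal p h k := by
        have h3 : e * pd p f ∈ jetIdeal p h k := by
          rw [eq_sub_of_add_eq' (hx f).symm]
          exact sub_mem h1 (derLog_mem_jetIdeal hp k hδ (iterate_pd_mem_jetIdeal p h le_rfl))
        exact (Ideal.mul_unit_mem_iff_mem _ ((isUnit_iff_value_ne_zero _).2 htop)).1 h3
      rw [hlift, hx]
      exact Ideal.mem_map_of_mem _ (add_mem (derLog_mem_jetIdeal hp k hδ hg)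
        (Ideal.mul_mem_right _ _ h2))
  have hIf : jetIdeal p h k ≤ Ideal.span {f} := by
    intro x hx
    rw [← hker]
    have := Ideal.mem_map_of_mem π hx
    rwa [hmap] at this
  have hprime : (Ideal.span {f}).IsPrime := by
    have : Ideal.span {f} = RingHom.ker π := by
      ext x
      rw [← hker, RingHom.mem_ker]
    rw [this]
    exact RingHom.ker_isPrime _
  have hmin := span_mem_minimalPrimes hprime hfm hD.ne_zero
    (hIf (iterate_pd_mem_jetIdeal p h (Nat.zero_le k)))
  -- Here `k ≥ 1` enters: `∂ₚ h` is in the jet ideal, thus in the minimal prime `(f)` over `(h)`.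
  have hdf := derivation_mem_of_mem_minimalPrimes hD.isRadical hmin (pd p)
    (hIf (iterate_pd_mem_jetIdeal p h hkpos)) (Ideal.mem_span_singleton_self f)
  exact htop ((mem_maximalIdeal_iff _).1 (hIm (hfI hdf)))

theorem isSmoothGerm_of_value₀_pd_ne_zero {n : ℕ} {h : 𝒪 n} (h0 : value₀ h = 0) {p : Fin n}
    (hp : value₀ (pd p h) ≠ 0) : IsSmoothGerm h := by
  obtain ⟨m, rfl⟩ : ∃ m, n = m + 1 := Nat.exists_eq_succ_of_ne_zero fun h0 => by
    subst h0
    exact p.elim0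
  obtain ⟨π, hπ, hker⟩ := exists_surjective_ker_eq_span p h0 hp
  have : Ideal.span {h} = RingHom.ker π := by
    ext x
    rw [← hker, RingHom.mem_ker]
  exact ⟨m, ⟨(Ideal.quotientEquivAlgOfEq ℂ this).trans
    (Ideal.quotientKerAlgEquivOfSurjective hπ)⟩⟩

/-! ### Smooth divisors -/

theorem mem_maximalIdeal_sq {n : ℕ} {g : 𝒪 n} (h0 : value₀ g = 0)
    (h1 : ∀ i, pd i g ∈ maximalIdeal (𝒪 n)) : g ∈ maximalIdeal (𝒪 n) ^ 2 := by
  obtain ⟨k, rfl⟩ := exists_eq_sum_coord_mul h0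
  rw [pow_two]
  refine sum_mem fun i _ => Ideal.mul_mem_mul (coord_mem i) ?_
  have h2 : pd i (∑ j, coord j * k j) = k i + ∑ j, coord j * pd i (k j) := by
    rw [map_sum]
    simp only [Derivation.leibniz, pd_coord, smul_eq_mul, Finset.sum_add_distrib]
    simp [add_comm]
  have h3 := h1 i
  rw [h2] at h3
  exact (Ideal.add_mem_iff_left _
    (sum_mem fun j _ => Ideal.mul_mem_right _ _ (coord_mem j))).1 h3

/-- Suppose `h ∈ 𝔪²`. A nonzero linear form `l` vanishing on `logTangent h` restricts to a germ on
`D` with zero derivatives at `0`, because vector fields on the smooth germ `D` lift to logarithmic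
ones. So `l ∈ 𝔪² + (h) = 𝔪²`, which is absurd. -/
theorem exists_value₀_pd_ne_zero_of_isSmoothGerm {n : ℕ} {h : 𝒪 n} (hD : IsReducedEquation h)
    (hs : IsSmoothGerm h) : ∃ p : Fin n, value₀ (pd p h) ≠ 0 := by
  by_contra! H
  have hh2 : h ∈ maximalIdeal (𝒪 n) ^ 2 := mem_maximalIdeal_sq hD.value_eq_zero fun i =>
    (mem_maximalIdeal_iff _).2 (H i)
  obtain ⟨m, ⟨e⟩⟩ := hs
  let ψ : 𝒪 n →ₐ[ℂ] 𝒪 m := e.toAlgHom.comp (Ideal.Quotient.mkₐ ℂ (Ideal.span {h}))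
  have hψ : Function.Surjective ψ := e.surjective.comp Ideal.Quotient.mk_surjective
  have hker : ∀ x, ψ x = 0 ↔ x ∈ Ideal.span {h} := by
    intro x
    rw [← Ideal.Quotient.eq_zero_iff_mem]
    exact map_eq_zero_iff e e.injective
  obtain ⟨f, hf0, hf⟩ := exists_functional_logTangent hD
  let l : 𝒪 n := ∑ i, algebraMap ℂ (𝒪 n) (f (Pi.single i 1)) * coord i
  have hl : value₀ l = 0 := by
    rw [← valueHom_apply]
    simp only [l, map_sum, map_mul, AlgHom.commutes]
    simp [valueHom_apply, value₀_coord]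
  have hψl : ψ l ∈ maximalIdeal (𝒪 m) ^ 2 := by
    refine mem_maximalIdeal_sq (by rw [value₀_algHom, hl]) fun j => ?_
    choose c hc using fun i => hψ (pd j (ψ (coord i)))
    have hlift : ∀ x, pd j (ψ x) = ψ (vecField c x) := by
      intro x
      rw [derivation_algHom_apply, vecField_apply, map_sum]
      exact Finset.sum_congr rfl fun i _ => by rw [map_mul, hc]
    have hlog : vecField c ∈ derLog h := by
      change vecField c h ∈ Ideal.span {h}
      rw [← hker, ← hlift, (hker h).2 (Ideal.mem_span_singleton_self h), map_zero]
    have h1 := hf (fun i => value₀ (c i)) ⟨vecField c, hlog, fun i => by rw [vecField_coord]⟩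
    rw [functional_apply] at h1
    rw [mem_maximalIdeal_iff, hlift, value₀_algHom, ← h1, ← valueHom_apply]
    have h2 : vecField c l = ∑ i, c i * algebraMap ℂ (𝒪 n) (f (Pi.single i 1)) := by
      simp only [l, map_sum, Derivation.leibniz, Derivation.map_algebraMap, vecField_coord,
        smul_eq_mul, mul_zero, zero_add, mul_comm]
    rw [h2, map_sum]
    refine Finset.sum_congr rfl fun i _ => ?_
    rw [map_mul, AlgHom.commutes, valueHom_apply]
    rfl
  have hmap : maximalIdeal (𝒪 m) = (maximalIdeal (𝒪 n)).map ψ := by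
    ext y
    rw [Ideal.mem_map_iff_of_surjective ψ hψ]
    constructor
    · intro hy
      obtain ⟨x, rfl⟩ := hψ y
      exact ⟨x, (algHom_mem_maximalIdeal ψ).1 hy, rfl⟩
    · rintro ⟨x, hx, rfl⟩
      exact (algHom_mem_maximalIdeal ψ).2 hx
  rw [hmap, ← Ideal.map_pow, Ideal.mem_map_iff_of_surjective ψ hψ] at hψl
  obtain ⟨q, hq, hql⟩ := hψl
  have h1 : l - q ∈ Ideal.span {h} := by
    rw [← hker, map_sub, hql, sub_self]
  have h2 : l ∈ maximalIdeal (𝒪 n) ^ 2 := by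
    rw [← sub_add_cancel l q]
    exact add_mem ((Ideal.span_singleton_le_iff_mem _).2 hh2 h1) hq
  apply hf0
  refine LinearMap.ext fun v => ?_
  rw [functional_apply]
  refine Finset.sum_eq_zero fun i _ => ?_
  have h3 := derivation_mem_pow (pd i) (maximalIdeal (𝒪 n)) 1 h2
  have h4 : pd i l = algebraMap ℂ (𝒪 n) (f (Pi.single i 1)) := by
    simp [l, pd_coord]
  rw [pow_one, h4, mem_maximalIdeal_iff, ← valueHom_apply, AlgHom.commutes] at h3
  change f (Pi.single i 1) = 0 at h3
  rw [h3, mul_zero]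

/-- When `∂ₚ h` is a unit, `dh ∧ a ≡ 0` solves to `a ≡ (aₚ / ∂ₚ h) dh` modulo `h`, so all residues
are holomorphic on `D` and `1` generates them. -/
theorem isPrincipal_residues_of_value₀_pd_ne_zero {n : ℕ} {h : 𝒪 n} (hD : IsReducedEquation h)
    {p : Fin n} (hp : value₀ (pd p h) ≠ 0) : (residues h).IsPrincipal := by
  obtain ⟨u, hu⟩ := (isUnit_iff_value_ne_zero _).2 hp
  have hu' : pd p h * ↑u⁻¹ = 1 := by rw [← hu, Units.mul_inv]
  refine ⟨⟨1, le_antisymm (fun r hr => ?_) ?_⟩⟩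
  · obtain ⟨a, rfl⟩ := (mem_residues_iff hD _).1 hr
    rw [residueMap_eq_algebraMap hD (ξ := (a : Fin n → 𝒪 n) p * ↑u⁻¹), Algebra.algebraMap_eq_smul_one]
    · exact Submodule.smul_mem _ _ (Submodule.mem_span_singleton_self _)
    · intro i
      refine ((a.2 p i).mul_left (↑u⁻¹ : 𝒪 n)).trans (dvd_of_eq ?_)
      linear_combination (a : Fin n → 𝒪 n) i * hu'
  · rw [Submodule.span_singleton_le_iff_mem]
    exact one_mem_residues hD

theorem isPrincipal_residues_iff_isSmoothGerm {n : ℕ} {h : 𝒪 n} (hD : IsReducedEquation h)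
    (hfree : IsFreeDivisor h) : (residues h).IsPrincipal ↔ IsSmoothGerm h := by
  constructor
  · intro hcyc
    obtain ⟨p, hp⟩ := exists_value₀_pd_ne_zero_of_isPrincipal hD hfree hcyc
    exact isSmoothGerm_of_value₀_pd_ne_zero hD.value_eq_zero hp
  · intro hs
    obtain ⟨p, hp⟩ := exists_value₀_pd_ne_zero_of_isSmoothGerm hD hs
    exact isPrincipal_residues_of_value₀_pd_ne_zero hD hp

end FreeDivisor

end

theorem proposition4p2 (n : ℕ) (h : 𝒪 n) (hD : IsReducedEquation h) (hfree : IsFreeDivisor h) :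
    (IsPartOfBasis (logForms h) (dlog h) ↔ IsEulerHomogeneous h) ∧
    (IsPartOfMinimalGenerators (residues h) 1 ↔
      ∀ h' : 𝒪 n, Ideal.span {h'} = Ideal.span {h} → IsPartOfBasis (logForms h) (dlog h')) ∧
    (IsAdaptedEquation h →
      (IsPartOfBasis (logForms h) (dlog h) ↔ IsPartOfMinimalGenerators (residues h) 1)) ∧
    ((residues h).IsPrincipal ↔ IsSmoothGerm h) :=
  ⟨isPartOfBasis_dlog_iff hD hfree, isPartOfMinimalGenerators_one_iff hD hfree,
    isPartOfBasis_dlog_iff_isPartOfMinimalGenerators hD hfree,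
    isPrincipal_residues_iff_isSmoothGerm hD hfree⟩
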